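/- Let $\Gamma=(X,R)$ be a finite connected simple graph with path-length distance $\partial$ and diameter $D$. Assume that $\Gamma$ is distance-regular, i.e. for all $0\le h,i,j\le D$ and all $x,y\in X$ with $\partial(x,y)=h$ the number $p^h_{ij}=|\{z\in X:\partial(x,z)=i,\ \partial(z,y)=j\}|$ does not depend on the choice of $x,y$. Put $c_i=p^i_{1,i-1}$ $(1\le i\le D)$, $b_i=p^i_{1,i+1}$ $(0\le i\le D-1)$, $k=b_0$ (the valency) and $d=\lfloor D/2\rfloor$. Let $\theta_0>\theta_1>\cdots>\theta_D$ be the distinct eigenvalues of the adjacency matrix $A$ of $\Gamma$. Put $$\Delta=(k-2)(c_3-1)-(c_2-1)p^2_{22},\qquad \tilde\theta_n=-1-\frac{b_2b_3}{\theta_n^2-b_2}\quad(n\in\{1,d\}).$$ The graph $\Gamma$ is called taut if $\Delta\neq0$ and $$b_3\bigl(b_2(k-2)-(c_2-1)\theta_1^2\bigr)\bigl(b_2(k-2)-(c_2-1)\theta_d^2\bigr)=b_1\Delta(\theta_1^2-b_2)(b_2-\theta_d^2).$$ For $x\in X$ let $E_i^*=E_i^*(x)$ $(0\le i\le D)$ be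 the diagonal matrix in $\mathrm{Mat}_X(\mathbb C)$ whose $(y,y)$ entry is $1$ if $\partial(x,y)=i$ and $0$ otherwise, and let $T(x)$ be the subalgebra of $\mathrm{Mat}_X(\mathbb C)$ generated by $A,E_0^*,\dots,E_D^*$. A $T(x)$-module is a subspace $W\subseteq\mathbb C^X$ with $BW\subseteq W$ for all $B\in T(x)$; it is irreducible if $W\ne0$ and the only $T(x)$-modules contained in $W$ are $0$ and $W$. The endpoint of an irreducible $T(x)$-module $W$ is $\min\{i: 0\le i\le D,\ E_i^*W\ne0\}$, and $W$ is thin if $\dim E_i^*W\le1$ for $0\le i\le D$. If $W$ is thin and irreducible with endpoint $2$, its local eigenvalue is the eigenvalue of $E_2^*A_2E_2^*$ on the one-dimensional space $E_2^*W$, where $A_2$ is the matrix with $(y,z)$ entry $1$ if $\partial(y,z)=2$ and $0$ otherwise. We say that $\Gamma$ is taut with respect to $x$ if every irreducible $T(x)$-module with endpoint $2$ is thin with local eigenvalue $\tilde\theta_1$ or $\tilde\theta_d$. **Theorem.** Let $\Gamma$ be a bipartite distance-regular graph with diameter $D\ge4$ and valency $k\ge3$, and assume that $D$ is odd. Then the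 following are equivalent: (i) $\Gamma$ is taut; (ii) $\Delta\ne0$ and $\Gamma$ is taut with respect to every vertex; (iii) $\Delta\ne0$ and $\Gamma$ is taut with respect to at least one vertex. -/

import Mathlib

open scoped Matrix

namespace SimpleGraph

variable {X : Type*} [Fintype X]

/-! ### Distance-regular graphs and their intersection numbers -/

/-- The number of vertices `z` with `∂(x,z) = i` and `∂(z,y) = j`. -/
noncomputable def distCount (G : SimpleGraph X) (x y : X) (i j : ℕ) : ℕ :=
  (Finset.univ.filter fun z => G.dist x z = i ∧ G.dist z y = j).card

/-- A connected finite graph is distance-regular if for all `h, i, j ≤ D` and all vertices `x, y`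
with `∂(x,y) = h`, the number of `z` with `∂(x,z) = i`, `∂(z,y) = j` is independent of `x, y`. -/
def IsDistanceRegular (G : SimpleGraph X) : Prop :=
  G.Connected ∧
    ∀ h i j : ℕ, h ≤ G.diam → i ≤ G.diam → j ≤ G.diam →
      ∀ x y x' y' : X, G.dist x y = h → G.dist x' y' = h →
        G.distCount x y i j = G.distCount x' y' i j

/-- The intersection number `p^h_{ij}`: the maximum over all pairs `x, y` at distance `h` of the
number of `z` with `∂(x,z) = i`, `∂(z,y) = j`. In a distance-regular graph this number is the same
for all such pairs, see `IsDistanceRegular.distCount_eq`. -/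
noncomputable def interNum (G : SimpleGraph X) (h i j : ℕ) : ℕ :=
  (Finset.univ.filter fun q : X × X => G.dist q.1 q.2 = h).sup fun q => G.distCount q.1 q.2 i j

theorem IsDistanceRegular.distCount_eq {G : SimpleGraph X} (hG : G.IsDistanceRegular)
    {i j : ℕ} (hi : i ≤ G.diam) (hj : j ≤ G.diam) (x y : X) :
    G.distCount x y i j = G.interNum (G.dist x y) i j := by
  have hfin : G.ediam ≠ ⊤ := by
    have := hG.1.nonempty
    exact connected_iff_ediam_ne_top.mp hG.1
  apply le_antisymm
  · exact Finset.le_sup (f := fun q : X × X => G.distCount q.1 q.2 i j)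
      (b := (x, y)) (by simp)
  · refine Finset.sup_le fun q hq => ?_
    exact (hG.2 _ i j (dist_le_diam hfin) hi hj q.1 q.2 x y (by simpa using hq) rfl).le

/-- `c_i = p^i_{1,i-1}` (and `c_0 = 0`). -/
noncomputable def drgC (G : SimpleGraph X) (i : ℕ) : ℕ := G.interNum i 1 (i - 1)

/-- `b_i = p^i_{1,i+1}`. -/
noncomputable def drgB (G : SimpleGraph X) (i : ℕ) : ℕ := G.interNum i 1 (i + 1)

/-- The valency `k = b_0`. -/
noncomputable def valency (G : SimpleGraph X) : ℕ := G.drgB 0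

variable [DecidableEq X]

/-- The list of distinct eigenvalues of the adjacency matrix, in decreasing order. -/
noncomputable def eigenvalueList (G : SimpleGraph X) [DecidableRel G.Adj] : List ℝ :=
  (Matrix.finite_real_spectrum (A := G.adjMatrix ℝ)).toFinset.sort (· ≥ ·)

/-- The eigenvalue `θ_i`, where `θ_0 > θ_1 > ⋯` are the distinct eigenvalues of the adjacency
matrix. (A distance-regular graph of diameter `D` has exactly `D + 1` of them; the default
value `0` is only used beyond the end of the list.) -/
noncomputable def theta (G : SimpleGraph X) [DecidableRel G.Adj] (i : ℕ) : ℝ :=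
  G.eigenvalueList.getD i 0

/-! ### The taut condition -/

/-- `Δ = (k - 2)(c_3 - 1) - (c_2 - 1) p^2_{22}`. -/
noncomputable def tautDelta (G : SimpleGraph X) : ℝ :=
  ((G.valency : ℝ) - 2) * ((G.drgC 3 : ℝ) - 1) - ((G.drgC 2 : ℝ) - 1) * (G.interNum 2 2 2 : ℝ)

/-- `Γ` is taut if `Δ ≠ 0` and, with `d = ⌊D/2⌋`,
`b_3 (b_2(k-2) - (c_2-1)θ_1²)(b_2(k-2) - (c_2-1)θ_d²) = b_1 Δ (θ_1² - b_2)(b_2 - θ_d²)`. -/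
def IsTaut (G : SimpleGraph X) [DecidableRel G.Adj] : Prop :=
  G.tautDelta ≠ 0 ∧
    (G.drgB 3 : ℝ) *
        ((G.drgB 2 : ℝ) * ((G.valency : ℝ) - 2) - ((G.drgC 2 : ℝ) - 1) * G.theta 1 ^ 2) *
        ((G.drgB 2 : ℝ) * ((G.valency : ℝ) - 2)
          - ((G.drgC 2 : ℝ) - 1) * G.theta (G.diam / 2) ^ 2) =
      (G.drgB 1 : ℝ) * G.tautDelta *
        (G.theta 1 ^ 2 - (G.drgB 2 : ℝ)) * ((G.drgB 2 : ℝ) - G.theta (G.diam / 2) ^ 2)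

/-- `z̃ = -1 - b_2 b_3 / (z² - b_2)`, for real `z` with `z² ≠ b_2`. -/
noncomputable def tildeVal (G : SimpleGraph X) (z : ℝ) : ℝ :=
  -1 - (G.drgB 2 : ℝ) * (G.drgB 3 : ℝ) / (z ^ 2 - (G.drgB 2 : ℝ))

/-! ### The subconstituent algebra and its modules -/

/-- The `i`-th distance matrix `A_i`. -/
noncomputable def distMatrix (G : SimpleGraph X) (i : ℕ) : Matrix X X ℂ :=
  Matrix.of fun y z => if G.dist y z = i then 1 else 0

/-- The `i`-th dual idempotent `E_i^*(x)`. -/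
noncomputable def dualIdem (G : SimpleGraph X) (x : X) (i : ℕ) : Matrix X X ℂ :=
  Matrix.diagonal fun y => if G.dist x y = i then 1 else 0

/-- The subconstituent (Terwilliger) algebra `T(x)`, generated by `A` and
`E_0^*(x), …, E_D^*(x)`. -/
noncomputable def subconstAlg (G : SimpleGraph X) [DecidableRel G.Adj] (x : X) :
    Subalgebra ℂ (Matrix X X ℂ) :=
  Algebra.adjoin ℂ ({G.adjMatrix ℂ} ∪ {B | ∃ i ≤ G.diam, B = G.dualIdem x i})

/-- A `T(x)`-module: a subspace of `ℂ^X` closed under the action of `T(x)`. -/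
def IsTModule (G : SimpleGraph X) [DecidableRel G.Adj] (x : X) (W : Submodule ℂ (X → ℂ)) : Prop :=
  ∀ B ∈ G.subconstAlg x, ∀ w ∈ W, B *ᵥ w ∈ W

/-- An irreducible `T(x)`-module. -/
def IsIrredTModule (G : SimpleGraph X) [DecidableRel G.Adj] (x : X)
    (W : Submodule ℂ (X → ℂ)) : Prop :=
  G.IsTModule x W ∧ W ≠ ⊥ ∧ ∀ W' : Submodule ℂ (X → ℂ), G.IsTModule x W' → W' ≤ W →
    W' = ⊥ ∨ W' = W

/-- The subspace `E_i^*(x) W`. -/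
noncomputable def dualPart (G : SimpleGraph X) (x : X) (i : ℕ) (W : Submodule ℂ (X → ℂ)) :
    Submodule ℂ (X → ℂ) :=
  W.map (G.dualIdem x i).mulVecLin

/-- `W` is thin (with respect to `x`): `dim E_i^* W ≤ 1` for `0 ≤ i ≤ D`. -/
def IsThin (G : SimpleGraph X) (x : X) (W : Submodule ℂ (X → ℂ)) : Prop :=
  ∀ i ≤ G.diam, Module.finrank ℂ (G.dualPart x i W) ≤ 1

/-- The endpoint of `W` (with respect to `x`): `min {i | 0 ≤ i ≤ D, E_i^* W ≠ 0}`. -/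
noncomputable def endpoint (G : SimpleGraph X) (x : X) (W : Submodule ℂ (X → ℂ)) : ℕ :=
  sInf {i : ℕ | i ≤ G.diam ∧ G.dualPart x i W ≠ ⊥}

/-- `η` is the local eigenvalue of `W`, for `W` a thin irreducible `T(x)`-module with endpoint 2:
the eigenvalue of `E_2^* A_2 E_2^*` on the one-dimensional space `E_2^* W`. -/
def HasLocalEigenvalue (G : SimpleGraph X) (x : X) (W : Submodule ℂ (X → ℂ)) (η : ℝ) : Prop :=
  ∀ v ∈ G.dualPart x 2 W,
    (G.dualIdem x 2 * G.distMatrix 2 * G.dualIdem x 2) *ᵥ v = (η : ℂ) • v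

/-- `Γ` is taut with respect to `x`: every irreducible `T(x)`-module with endpoint 2 is thin with
local eigenvalue `θ̃_1` or `θ̃_d`, where `d = ⌊D/2⌋`. -/
def IsTautAt (G : SimpleGraph X) [DecidableRel G.Adj] (x : X) : Prop :=
  ∀ W : Submodule ℂ (X → ℂ), G.IsIrredTModule x W → G.endpoint x W = 2 →
    G.IsThin x W ∧
      (G.HasLocalEigenvalue x W (G.tildeVal (G.theta 1)) ∨
        G.HasLocalEigenvalue x W (G.tildeVal (G.theta (G.diam / 2))))

end SimpleGraph

/-! Fix a vertex x. Put B = E_2^* A_2 E_2^*, N = E_2^* A E_1^*, and let P be the orthogonal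
projection onto the vectors of E_2^* C^X killed by N^*; for an irreducible module W of endpoint 2
the space E_2^* W lies in the range of P. The proof pivots on the Hermitian matrix M = (B - θ̃_1)(B
- θ̃_d)P (`tautMat`): the taut equation says tr M = 0, tautness at x says M = 0, and positivity
makes the two agree. The condition Δ ≠ 0 is common to all three statements.

Trace. P is an explicit combination of E_2^*, N N^* and E_2^* J E_2^*, so the traces of P, BP and
B²P are functions of the intersection numbers. Hence tr M does not depend on x, which is why one
vertex decides for all, and it vanishes exactly when the taut equation holds (`isTaut_iff`); this
needs b_2 ≠ 1.

Positivity. Let E be positive semidefinite with AE = θE and with entries e_i depending only on the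
distance i. Vertices at distance 2 from x are mutually at distance 0, 2 or 4, and PJ = 0, so the
cosine recurrence gives PEP = (e_2 - e_4)(B - θ̃)P (`locProj_sandwich`). Applied to θ_1 and θ_d,
this makes M a nonzero multiple of a product of two positive semidefinite matrices, and such a
product vanishes once its trace does (`trace_tautMat_eq_zero_iff`).

Modules. If M = 0, then E_2^* W contains an eigenvector v of B for θ̃_1 or θ̃_d, and the Gram form
of PEP gives Ev = 0. Together with Jv = 0 this makes each E_i^* A_j v a multiple of E_i^* A_{i-2} v,
provided that e_i ≠ e_{i+2}; so v generates a thin module (`thin_of_locB_eigenvector`). The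
inequality holds because θ_1² and θ_d² are the extreme squares of the nontrivial eigenvalues
(`cosine_ne`); here D odd enters. Conversely, if x is taut then M kills every irreducible module,
and these leave no nonzero orthogonal complement (`tautMat_eq_zero_of_isTautAt`). -/

namespace SimpleGraph

/-- A bipartite distance-regular graph. -/
structure IsBipartiteDRG {X : Type*} [Fintype X] (G : SimpleGraph X) : Prop where
  drg : G.IsDistanceRegular
  bip : G.IsBipartite

/-! ### Geodesics and parity of distances in a bipartite graph. -/

section Distance

variable {X : Type*} {G : SimpleGraph X}

theorem Connected.exists_dist_split (hG : G.Connected) {y z : X} {j : ℕ} (hj : j ≤ G.dist y z) :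
    ∃ w, G.dist y w = j ∧ j + G.dist w z = G.dist y z := by
  obtain ⟨p, hp⟩ := hG.exists_walk_length_eq_dist y z
  refine ⟨p.getVert j, ?_⟩
  have h1 := G.dist_le (p.take j)
  have h2 := G.dist_le (p.drop j)
  have h3 := hG.dist_triangle (u := y) (v := p.getVert j) (w := z)
  simp only [Walk.take_length, Walk.drop_length] at h1 h2
  omega

/-- The parity of a distance records whether the two colours agree, and around a triple the number
of disagreements is even. -/
theorem Connected.even_dist_add (hG : G.Connected) (hb : G.IsBipartite) (x y z : X) :
    Even (G.dist x y + G.dist y z + G.dist x z) := by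
  obtain ⟨c'⟩ := hb
  let c : G.Coloring Bool := G.recolorOfEquiv finTwoEquiv c'
  have key : ∀ u v, Even (G.dist u v) ↔ (c u ↔ c v) := fun u v => by
    obtain ⟨p, hp⟩ := hG.exists_walk_length_eq_dist u v
    rw [← hp, c.even_length_iff_congr p]
  rw [Nat.even_add, Nat.even_add, key, key, key]
  tauto

theorem Connected.dist_of_adj (hG : G.Connected) (hb : G.IsBipartite) {y w : X} (h : G.Adj y w)
    (z : X) : G.dist w z = G.dist y z + 1 ∨ G.dist w z + 1 = G.dist y z := by
  have h1 := dist_eq_one_iff_adj.2 h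
  have h2 := hG.dist_triangle (u := y) (v := w) (w := z)
  have h3 := hG.dist_triangle (u := w) (v := y) (w := z)
  rw [G.dist_comm (u := w) (v := y)] at h3
  have h4 := hG.even_dist_add hb y w z
  rw [Nat.even_iff] at h4
  omega

end Distance

/-! ### Intersection numbers of a bipartite distance-regular graph. -/

section Counting

variable {X : Type*} [Fintype X] {G : SimpleGraph X}

theorem IsDistanceRegular.dist_le (hG : G.IsDistanceRegular) (x y : X) :
    G.dist x y ≤ G.diam := by
  have := hG.1.nonempty
  exact dist_le_diam (connected_iff_ediam_ne_top.mp hG.1)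

theorem IsDistanceRegular.exists_dist_eq (hG : G.IsDistanceRegular) {i : ℕ} (hi : i ≤ G.diam) :
    ∃ y z, G.dist y z = i := by
  have := hG.1.nonempty
  obtain ⟨u, v, huv⟩ := G.exists_dist_eq_diam
  obtain ⟨w, hw, -⟩ := hG.1.exists_dist_split (y := u) (z := v) (j := i) (by omega)
  exact ⟨u, w, hw⟩

theorem interNum_eq_zero {h i j : ℕ} (H : ∀ x y : X, G.dist x y = h → G.distCount x y i j = 0) :
    G.interNum h i j = 0 := by
  rw [interNum, ← Nat.bot_eq_zero, Finset.sup_eq_bot_iff]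
  rintro ⟨x, y⟩ hq
  exact H x y (by simpa using hq)

theorem distCount_eq_zero {x y : X} {i j : ℕ}
    (H : ∀ z, G.dist x z = i → G.dist z y = j → False) : G.distCount x y i j = 0 := by
  rw [distCount, Finset.card_eq_zero, Finset.filter_eq_empty_iff]
  exact fun z _ hz => H z hz.1 hz.2

theorem drgB_zero : G.drgB 0 = G.valency := rfl

namespace IsBipartiteDRG

variable (hG : G.IsBipartiteDRG)
include hG

theorem conn : G.Connected := hG.drg.1

theorem dist_le (x y : X) : G.dist x y ≤ G.diam := hG.drg.dist_le x y

theorem even_dist (x y z : X) : (G.dist x y + G.dist y z + G.dist x z) % 2 = 0 :=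
  Nat.even_iff.1 (hG.conn.even_dist_add hG.bip x y z)

theorem dist_tri (x y z : X) : G.dist x z ≤ G.dist x y + G.dist y z := hG.conn.dist_triangle

theorem distCount_eq {i j : ℕ} (hi : i ≤ G.diam) (hj : j ≤ G.diam) (x y : X) :
    G.distCount x y i j = G.interNum (G.dist x y) i j := hG.drg.distCount_eq hi hj x y

theorem interNum_one {h j : ℕ} :
    G.interNum h 1 j = if h + 1 = j then G.drgB h else if j + 1 = h then G.drgC h else 0 := by
  split_ifs with h1 h2
  · subst h1; rfl
  · subst h2; rfl
  · refine interNum_eq_zero fun x y hxy => distCount_eq_zero fun z hxz hzy => ?_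
    have := hG.conn.dist_of_adj hG.bip (dist_eq_one_iff_adj.1 hxz) y
    omega

theorem drgC_pos {i : ℕ} (h1 : 1 ≤ i) (hi : i ≤ G.diam) : 0 < G.drgC i := by
  obtain ⟨y, z, hyz⟩ := hG.drg.exists_dist_eq hi
  obtain ⟨w, hw, hwz⟩ := hG.conn.exists_dist_split (y := y) (z := z) (j := 1) (by omega)
  rw [drgC, ← hyz, ← hG.distCount_eq (by omega) (by omega), distCount, Finset.card_pos]
  exact ⟨w, by simp only [Finset.mem_filter, Finset.mem_univ, true_and]; omega⟩

theorem drgB_pos {i : ℕ} (hi : i < G.diam) : 0 < G.drgB i := by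
  obtain ⟨y, z, hyz⟩ := hG.drg.exists_dist_eq (i := i + 1) hi
  obtain ⟨w, hw, hwz⟩ := hG.conn.exists_dist_split (y := y) (z := z) (j := 1) (by omega)
  have hwz' : G.dist w z = i := by omega
  rw [drgB, ← hwz', ← hG.distCount_eq (by omega) (by omega), distCount, Finset.card_pos]
  refine ⟨y, ?_⟩
  simp only [Finset.mem_filter, Finset.mem_univ, true_and]
  rw [G.dist_comm]
  omega

theorem drgB_diam {i : ℕ} (hi : G.diam ≤ i) : G.drgB i = 0 := by
  refine interNum_eq_zero fun x y hxy => distCount_eq_zero fun z hxz hzy => ?_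
  have := hG.dist_le z y
  omega

/-- Truncated subtraction turns `i - 1` into 0 at `i = 0`, so the count asks for a neighbour of a
vertex that equals this vertex. -/
theorem drgC_zero : G.drgC 0 = 0 := by
  refine interNum_eq_zero fun x y hxy => distCount_eq_zero fun z hxz hzy => ?_
  have h1 := hG.dist_tri x y z
  have h2 : G.dist z y = 0 := by simpa using hzy
  rw [G.dist_comm (u := y)] at h1
  omega

theorem drgC_one (h1 : 1 ≤ G.diam) : G.drgC 1 = 1 := by
  obtain ⟨y, z, hyz⟩ := hG.drg.exists_dist_eq h1
  have hC : G.drgC 1 = G.distCount y z 1 0 := by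
    rw [drgC, hG.distCount_eq h1 (Nat.zero_le _), hyz]
  rw [hC, distCount, Finset.card_eq_one]
  refine ⟨z, ?_⟩
  ext w
  simp only [Finset.mem_filter, Finset.mem_univ, true_and, Finset.mem_singleton]
  constructor
  · rintro ⟨-, h⟩
    exact hG.conn.dist_eq_zero_iff.1 (by omega)
  · rintro rfl
    simp [hyz]

theorem card_dist_one (h1 : 1 ≤ G.diam) (y : X) :
    (Finset.univ.filter fun z => G.dist y z = 1).card = G.valency := by
  rw [valency, drgB, ← G.dist_self (v := y), ← hG.distCount_eq (by omega) (by simpa), distCount]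
  congr 1
  ext z
  simp [G.dist_comm (u := z)]

/-- In a bipartite graph no neighbour keeps the same distance, so all neighbours are counted by the
two numbers. -/
theorem drgC_add_drgB (h1 : 1 ≤ G.diam) {i : ℕ} (hi : i ≤ G.diam) :
    G.drgC i + G.drgB i = G.valency := by
  classical
  obtain ⟨y, z, rfl⟩ := hG.drg.exists_dist_eq hi
  rcases Nat.eq_zero_or_pos (G.dist y z) with h0 | h0
  · rw [h0, hG.drgC_zero, zero_add, drgB_zero]
  rw [← hG.card_dist_one h1 y, drgC, ← hG.distCount_eq h1 (by omega), distCount]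
  -- Distance-regularity does not cover the index D + 1, so at distance D both sides are seen to be
  -- zero separately.
  have hB : G.drgB (G.dist y z) = (Finset.univ.filter fun w =>
      G.dist y w = 1 ∧ G.dist w z = G.dist y z + 1).card := by
    rcases hi.lt_or_eq with hlt | heq
    · rw [drgB, ← hG.distCount_eq h1 hlt, distCount]
    · rw [hG.drgB_diam heq.ge, eq_comm, Finset.card_eq_zero, Finset.filter_eq_empty_iff]
      rintro w - ⟨-, hw⟩
      have := hG.dist_le w z
      omega
  rw [hB, ← Finset.card_union_of_disjoint]
  · congr 1
    ext w
    simp only [Finset.mem_union, Finset.mem_filter, Finset.mem_univ, true_and]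
    constructor
    · rintro (h | h) <;> exact h.1
    · intro h
      have := hG.conn.dist_of_adj hG.bip (dist_eq_one_iff_adj.1 h) z
      omega
  · rw [Finset.disjoint_filter]
    omega

end IsBipartiteDRG

end Counting

/-! ### Distance matrices, their partial sums Q_i, and trace identities. -/

section DistanceMatrices

variable {X : Type*} (R : Type*) [CommRing R] (G : SimpleGraph X)

/-- The `i`-th distance matrix over a ring `R`. -/
noncomputable def distMat (i : ℕ) : Matrix X X R :=
  Matrix.of fun y z => if G.dist y z = i then 1 else 0

variable {R G}

theorem distMat_apply (i : ℕ) (y z : X) :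
    G.distMat R i y z = if G.dist y z = i then 1 else 0 := rfl

theorem distMat_transpose (i : ℕ) : (G.distMat R i)ᵀ = G.distMat R i := by
  ext y z
  simp [distMat_apply, G.dist_comm (u := z)]

theorem distMat_one [DecidableRel G.Adj] : G.distMat R 1 = G.adjMatrix R := by
  ext y z
  simp [distMat_apply, dist_eq_one_iff_adj]

variable [Fintype X]

theorem distMat_mul_apply (i : ℕ) (M : Matrix X X R) (y z : X) :
    (G.distMat R i * M) y z = ∑ w with G.dist y w = i, M w z := by
  simp [Matrix.mul_apply, distMat_apply, Finset.sum_filter]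

theorem distMat_mul_distMat_apply (i j : ℕ) (y z : X) :
    (G.distMat R i * G.distMat R j) y z = (G.distCount y z i j : R) := by
  rw [distMat_mul_apply, distCount]
  simp [distMat_apply, Finset.filter_filter]

namespace IsBipartiteDRG

variable (hG : G.IsBipartiteDRG)
include hG

theorem distMat_zero [DecidableEq X] : G.distMat R 0 = 1 := by
  ext y z
  simp [distMat_apply, hG.conn.dist_eq_zero_iff, Matrix.one_apply]

theorem distMat_eq_zero {i : ℕ} (hi : G.diam < i) : G.distMat R i = 0 := by
  ext y z
  have := hG.dist_le y z
  simp only [distMat_apply, Matrix.zero_apply, ite_eq_right_iff]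
  omega

/-- `(b_j + c_j) A_j = k A_j`, valid for all `j`. -/
theorem valency_smul_distMat (h1 : 1 ≤ G.diam) (j : ℕ) :
    (G.valency : R) • G.distMat R j
      = (G.drgC j : R) • G.distMat R j + (G.drgB j : R) • G.distMat R j := by
  rcases le_or_gt j G.diam with hj | hj
  · rw [← add_smul, ← hG.drgC_add_drgB h1 hj]
    push_cast
    rfl
  · simp [hG.distMat_eq_zero hj]

/-- The three-term recurrence `A A_{j+1} = b_j A_j + c_{j+2} A_{j+2}`. -/
theorem distMat_one_mul (h1 : 1 ≤ G.diam) (j : ℕ) :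
    G.distMat R 1 * G.distMat R (j + 1)
      = (G.drgB j : R) • G.distMat R j + (G.drgC (j + 2) : R) • G.distMat R (j + 2) := by
  rcases le_or_gt (j + 1) G.diam with hj | hj
  · ext y z
    rw [distMat_mul_distMat_apply, hG.distCount_eq h1 hj, hG.interNum_one]
    simp only [Matrix.add_apply, Matrix.smul_apply, distMat_apply, smul_eq_mul]
    by_cases h : G.dist y z = j
    · simp [h]
    · by_cases h' : G.dist y z = j + 2
      · simp [h']
      · simp only [h, h', if_false]
        have a2 : ¬ j + 1 + 1 = G.dist y z := by omega
        simp [a2, h]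
  · rw [hG.distMat_eq_zero hj, hG.distMat_eq_zero (i := j + 2) (by omega),
      hG.drgB_diam (by omega)]
    simp

theorem commute_distMat_one (h1 : 1 ≤ G.diam) (j : ℕ) :
    G.distMat R j * G.distMat R 1 = G.distMat R 1 * G.distMat R j := by
  classical
  cases j with
  | zero => simp [hG.distMat_zero]
  | succ j =>
    have h := congrArg Matrix.transpose (hG.distMat_one_mul (R := R) h1 j)
    simp only [Matrix.transpose_mul, Matrix.transpose_add, Matrix.transpose_smul,
      distMat_transpose] at h
    rw [h, hG.distMat_one_mul h1 j]

end IsBipartiteDRG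

variable (R G) in
/-- The matrix `∑ A_j`, over `j ≤ i` with `j ≡ i` modulo 2. -/
noncomputable def distSum : ℕ → Matrix X X R
  | 0 => G.distMat R 0
  | 1 => G.distMat R 1
  | i + 2 => distSum i + G.distMat R (i + 2)

theorem distSum_apply_eq_zero {i : ℕ} {y z : X} (h : i < G.dist y z) :
    G.distSum R i y z = 0 := by
  induction i using Nat.twoStepInduction with
  | zero => simp only [distSum, distMat_apply, ite_eq_right_iff]; omega
  | one => simp only [distSum, distMat_apply, ite_eq_right_iff]; omega
  | more i ih1 _ =>
    simp only [distSum, Matrix.add_apply, ih1 (by omega), distMat_apply, zero_add,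
      ite_eq_right_iff]
    omega

theorem distSum_apply_self {i : ℕ} {y z : X} (h : G.dist y z = i) : G.distSum R i y z = 1 := by
  match i with
  | 0 => simp [distSum, distMat_apply, h]
  | 1 => simp [distSum, distMat_apply, h]
  | i + 2 =>
    simp [distSum, distMat_apply, h, distSum_apply_eq_zero (R := R) (show i < G.dist y z by omega)]

namespace IsBipartiteDRG

variable (hG : G.IsBipartiteDRG)
include hG

/-- The product A Q_i counts neighbours of y within distance i of z. All k of them qualify when
∂(y,z) ≤ i - 1, and c_{i+1} = k - b_{i+1} of them when ∂(y,z) = i + 1; the term in A_{i+1} restores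
the missing ones. -/
theorem distMat_one_mul_distSum (h1 : 1 ≤ G.diam) (i : ℕ) :
    G.distMat R 1 * G.distSum R i + (G.drgB (i + 1) : R) • G.distMat R (i + 1)
      = (G.valency : R) • G.distSum R (i + 1) := by
  classical
  induction i using Nat.twoStepInduction with
  | zero =>
    rw [distSum, distSum, hG.valency_smul_distMat h1, hG.distMat_zero, hG.drgC_one h1]
    simp
  | one =>
    rw [distSum, distSum, distSum, hG.distMat_one_mul h1 0, drgB_zero, smul_add,
      hG.valency_smul_distMat h1 (0 + 2)]
    simp only [zero_add]
    abel
  | more i ih1 _ =>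
    rw [distSum, distSum, smul_add, ← ih1, mul_add, hG.distMat_one_mul h1 (i + 1),
      hG.valency_smul_distMat h1 (i + 2 + 1)]
    simp only [show i + 1 + 2 = i + 2 + 1 by ring]
    abel

theorem distMat_one_mul_distSum_succ (h1 : 1 ≤ G.diam) (i : ℕ) :
    G.distMat R 1 * G.distSum R (i + 1)
      = (G.valency : R) • G.distSum R i + (G.drgC (i + 2) : R) • G.distMat R (i + 2) := by
  have h := hG.distMat_one_mul_distSum (R := R) h1 (i + 1)
  rw [distSum, smul_add, hG.valency_smul_distMat h1 (i + 2), ← add_assoc] at h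
  exact add_right_cancel h

/-- The Christoffel-type identity `(k² - A²) Q_i = b_i b_{i+1} A_i - c_{i+1} c_{i+2} A_{i+2}`. -/
theorem valency_sq_sub_mul_distSum (h1 : 1 ≤ G.diam) (i : ℕ) :
    ((G.valency : R) ^ 2) • G.distSum R i - G.distMat R 1 * (G.distMat R 1 * G.distSum R i)
      = ((G.drgB i : R) * G.drgB (i + 1)) • G.distMat R i
        - ((G.drgC (i + 1) : R) * G.drgC (i + 2)) • G.distMat R (i + 2) := by
  have e1 := hG.distMat_one_mul_distSum (R := R) h1 i
  have e2 := hG.distMat_one_mul_distSum_succ (R := R) h1 i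
  have e3 := hG.distMat_one_mul (R := R) h1 i
  have e4 : G.distMat R 1 * G.distSum R i = (G.valency : R) • G.distSum R (i + 1)
      - (G.drgB (i + 1) : R) • G.distMat R (i + 1) := eq_sub_of_add_eq e1
  rw [e4, mul_sub, Matrix.mul_smul, Matrix.mul_smul, e2, e3]
  rcases le_or_gt (i + 1) G.diam with hi | hi
  · rw [← hG.drgC_add_drgB h1 hi]
    push_cast
    module
  · rw [hG.drgB_diam hi.le, hG.distMat_eq_zero (i := i + 2) (by omega)]
    push_cast
    module

/-- The trace of `A_i A_j`. -/
theorem trace_distMat_mul_distMat (i j : ℕ) :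
    (G.distMat R i * G.distMat R j).trace
      = if i = j then ∑ y : X, ∑ z : X, (if G.dist y z = i then 1 else 0) else 0 := by
  simp only [Matrix.trace, Matrix.diag_apply, Matrix.mul_apply, distMat_apply]
  split_ifs with h
  · subst h
    refine Finset.sum_congr rfl fun y _ => Finset.sum_congr rfl fun z _ => ?_
    rw [G.dist_comm (u := z)]
    split_ifs <;> simp
  · refine Finset.sum_eq_zero fun y _ => Finset.sum_eq_zero fun z _ => ?_
    rw [G.dist_comm (u := z)]
    split_ifs <;> simp_all

/-- Both sides are the trace of A_i A A_{i+1}, expanded by the recurrence on the right factor and on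
the left one. This is the edge count k_i b_i = k_{i+1} c_{i+1} in disguise. -/
theorem drgB_mul_trace (h1 : 1 ≤ G.diam) (i : ℕ) :
    (G.drgB i : R) * (G.distMat R i * G.distMat R i).trace
      = G.drgC (i + 1) * (G.distMat R (i + 1) * G.distMat R (i + 1)).trace := by
  classical
  have e1 : (G.distMat R i * (G.distMat R 1 * G.distMat R (i + 1))).trace
      = (G.drgB i : R) * (G.distMat R i * G.distMat R i).trace := by
    rw [hG.distMat_one_mul h1, mul_add, Matrix.trace_add, Matrix.mul_smul, Matrix.mul_smul,
      Matrix.trace_smul, Matrix.trace_smul, hG.trace_distMat_mul_distMat i (i + 2), if_neg (by omega)]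
    simp
  rw [← e1, ← mul_assoc, hG.commute_distMat_one h1]
  cases i with
  | zero => simp [hG.distMat_zero, hG.drgC_one h1]
  | succ j =>
    rw [hG.distMat_one_mul h1, add_mul, Matrix.trace_add, Matrix.smul_mul, Matrix.smul_mul,
      Matrix.trace_smul, Matrix.trace_smul, hG.trace_distMat_mul_distMat j (j + 1 + 1), if_neg (by omega)]
    simp

end IsBipartiteDRG

end DistanceMatrices

end SimpleGraph

/-! ### Polynomials in a real symmetric matrix. -/

section HermitianPolynomial

open Polynomial

variable {V : Type*} [Fintype V] [DecidableEq V] {A : Matrix V V ℝ}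

theorem Matrix.mem_spectrum_iff_exists_mulVec {μ : ℝ} :
    μ ∈ spectrum ℝ A ↔ ∃ u : V → ℝ, u ≠ 0 ∧ A *ᵥ u = μ • u := by
  rw [← Matrix.spectrum_toLin', ← Module.End.hasEigenvalue_iff_mem_spectrum]
  constructor
  · intro h
    obtain ⟨u, hu⟩ := h.exists_hasEigenvector
    exact ⟨u, hu.2, by simpa using hu.apply_eq_smul⟩
  · rintro ⟨u, hu, h⟩
    exact Module.End.hasEigenvalue_of_hasEigenvector
      (x := u) ⟨Module.End.mem_eigenspace_iff.2 (by simpa using h), hu⟩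

theorem Matrix.aeval_mulVec_of_mulVec_eq {μ : ℝ} {u : V → ℝ} (h : A *ᵥ u = μ • u) (g : ℝ[X]) :
    aeval A g *ᵥ u = g.eval μ • u := by
  induction g using Polynomial.induction_on' with
  | add p q hp hq => simp [Matrix.add_mulVec, hp, hq, add_smul]
  | monomial n a =>
    have : ∀ n : ℕ, A ^ n *ᵥ u = μ ^ n • u := fun n => by
      induction n with
      | zero => simp
      | succ n ih => rw [pow_succ, ← Matrix.mulVec_mulVec, h, Matrix.mulVec_smul, ih, smul_smul,
          pow_succ, mul_comm]
    rw [aeval_monomial, Algebra.algebraMap_eq_smul_one, smul_mul_assoc, one_mul,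
      Matrix.smul_mulVec, this, smul_smul, eval_monomial]

theorem Matrix.aeval_mul_of_mul_eq {μ : ℝ} {E : Matrix V V ℝ} (h : A * E = μ • E) (g : ℝ[X]) :
    aeval A g * E = g.eval μ • E := by
  ext y z
  have h' : A *ᵥ (fun w => E w z) = μ • (fun w => E w z) := by
    ext w
    exact congrFun (congrFun h w) z
  exact congrFun (Matrix.aeval_mulVec_of_mulVec_eq h' g) y

variable (hA : A.IsHermitian)
include hA

theorem Matrix.IsHermitian.aeval_eq (g : ℝ[X]) :
    aeval A g = Unitary.conjStarAlgAut ℝ _ hA.eigenvectorUnitary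
      (diagonal fun j => g.eval (hA.eigenvalues j)) := by
  conv_lhs => rw [hA.spectral_theorem]
  have h1 := aeval_algHom_apply (Unitary.conjStarAlgAut ℝ (Matrix V V ℝ) hA.eigenvectorUnitary)
    (diagonal (RCLike.ofReal ∘ hA.eigenvalues) : Matrix V V ℝ) g
  have h2 := aeval_algHom_apply (Matrix.diagonalAlgHom ℝ (n := V) (α := ℝ))
    (RCLike.ofReal ∘ hA.eigenvalues : V → ℝ) g
  rw [h1]
  congr 1
  simp only [Matrix.diagonalAlgHom_apply] at h2
  rw [h2, aeval_pi_apply]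
  congr 1

theorem Matrix.IsHermitian.trace_aeval (g : ℝ[X]) :
    (aeval A g).trace = ∑ j, g.eval (hA.eigenvalues j) := by
  rw [hA.aeval_eq, Unitary.conjStarAlgAut_apply, Matrix.trace_mul_comm, ← mul_assoc]
  simp [Matrix.trace_diagonal]

theorem Matrix.IsHermitian.aeval_eq_zero_iff {g : ℝ[X]} :
    aeval A g = 0 ↔ ∀ μ ∈ spectrum ℝ A, g.eval μ = 0 := by
  constructor
  · intro h μ hμ
    obtain ⟨u, hu, h'⟩ := Matrix.mem_spectrum_iff_exists_mulVec.1 hμ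
    have := Matrix.aeval_mulVec_of_mulVec_eq h' g
    rw [h, Matrix.zero_mulVec] at this
    exact (smul_eq_zero.1 this.symm).resolve_right hu
  · intro h
    rw [hA.aeval_eq]
    have : (fun j => g.eval (hA.eigenvalues j)) = 0 :=
      funext fun j => h _ (hA.eigenvalues_mem_spectrum_real j)
    rw [this]
    simp

/-- The trace is the sum of the values of g over the eigenvalues with multiplicity, and a vanishing
sum of nonnegative terms has only zero terms. -/
theorem Matrix.IsHermitian.eval_eq_zero_of_trace_aeval_eq_zero {g : ℝ[X]}
    (h0 : ∀ μ ∈ spectrum ℝ A, 0 ≤ g.eval μ) (ht : (aeval A g).trace = 0) :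
    ∀ μ ∈ spectrum ℝ A, g.eval μ = 0 := by
  rw [hA.trace_aeval, Finset.sum_eq_zero_iff_of_nonneg
    (fun j _ => h0 _ (hA.eigenvalues_mem_spectrum_real j))] at ht
  intro μ hμ
  rw [hA.spectrum_real_eq_range_eigenvalues] at hμ
  obtain ⟨j, rfl⟩ := hμ
  exact ht j (Finset.mem_univ j)

end HermitianPolynomial

namespace SimpleGraph

/-! ### The spectrum of the adjacency matrix: symmetry, bounds and size. -/

section Spectrum

open Polynomial

variable {V : Type*} [Fintype V] [DecidableEq V] {G : SimpleGraph V} [DecidableRel G.Adj]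

theorem isHermitian_adjMatrix_real : (G.adjMatrix ℝ).IsHermitian := by
  rw [Matrix.IsHermitian, Matrix.conjTranspose_eq_transpose_of_trivial, transpose_adjMatrix]

theorem adjMatrix_pow_apply_of_lt_dist {n : ℕ} {y z : V} (h : n < G.dist y z) :
    (G.adjMatrix ℝ ^ n) y z = 0 := by
  rw [adjMatrix_pow_apply_eq_card_walk, Nat.cast_eq_zero, Fintype.card_eq_zero_iff]
  refine ⟨fun p => ?_⟩
  have h1 := G.dist_le p.1
  have h2 : p.1.length = n := p.2
  omega

theorem aeval_adjMatrix_apply_of_lt_dist {g : ℝ[X]} {y z : V} (h : g.natDegree < G.dist y z) :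
    (aeval (G.adjMatrix ℝ) g) y z = 0 := by
  rw [aeval_eq_sum_range, Matrix.sum_apply]
  refine Finset.sum_eq_zero fun n hn => ?_
  rw [Matrix.smul_apply, adjMatrix_pow_apply_of_lt_dist, smul_zero]
  have := Finset.mem_range.1 hn
  omega

namespace IsBipartiteDRG

variable (hG : G.IsBipartiteDRG)
include hG

/-- At a pair of vertices whose distance is the degree of g, only the leading power of A has a
nonzero entry. -/
theorem natDegree_gt_of_aeval_eq_zero {g : ℝ[X]} (h0 : g ≠ 0)
    (h : aeval (G.adjMatrix ℝ) g = 0) : G.diam < g.natDegree := by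
  by_contra! hle
  obtain ⟨y, z, hyz⟩ := hG.drg.exists_dist_eq hle
  have h1 := congrFun (congrFun h y) z
  rw [aeval_eq_sum_range, Matrix.sum_apply, Finset.sum_range_succ, Finset.sum_eq_zero] at h1
  · rw [zero_add, Matrix.smul_apply, Matrix.zero_apply, smul_eq_mul, mul_eq_zero] at h1
    rcases h1 with h1 | h1
    · exact h0 (leadingCoeff_eq_zero.1 h1)
    · rw [adjMatrix_pow_apply_eq_card_walk, Nat.cast_eq_zero, Fintype.card_eq_zero_iff] at h1
      obtain ⟨p, hp⟩ := hG.conn.exists_walk_length_eq_dist y z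
      exact h1.elim ⟨p, hp.trans hyz⟩
  · intro n hn
    rw [Matrix.smul_apply, adjMatrix_pow_apply_of_lt_dist, smul_zero]
    have := Finset.mem_range.1 hn
    omega

theorem exists_aeval_apply_eq (g : ℝ[X]) :
    ∃ e : ℕ → ℝ, ∀ y z, (aeval (G.adjMatrix ℝ) g) y z = e (G.dist y z) := by
  induction g using Polynomial.induction_on with
  | C a =>
    refine ⟨fun i => if i = 0 then a else 0, fun y z => ?_⟩
    simp [Matrix.algebraMap_matrix_apply, hG.conn.dist_eq_zero_iff]
  | add p q hp hq =>
    obtain ⟨e, he⟩ := hp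
    obtain ⟨f, hf⟩ := hq
    exact ⟨e + f, fun y z => by simp [he, hf]⟩
  | monomial n a ih =>
    obtain ⟨e, he⟩ := ih
    -- Intersection numbers with index 1 are controlled only when D ≥ 1; for D = 0 there is a single
    -- vertex.
    rcases Nat.eq_zero_or_pos G.diam with h0 | h1
    · refine ⟨fun _ => aeval (G.adjMatrix ℝ) (C a * X ^ (n + 1)) (hG.conn.nonempty.some)
        (hG.conn.nonempty.some), fun y z => ?_⟩
      have : ∀ u v : V, u = v := fun u v => by
        have := hG.dist_le u v
        exact hG.conn.dist_eq_zero_iff.1 (by omega)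
      rw [this y hG.conn.nonempty.some, this z hG.conn.nonempty.some]
    refine ⟨fun h => ∑ j ∈ Finset.range (G.diam + 1), (G.interNum h 1 j : ℝ) * e j,
      fun y z => ?_⟩
    have hc : aeval (G.adjMatrix ℝ) (C a * X ^ (n + 1))
        = G.distMat ℝ 1 * aeval (G.adjMatrix ℝ) (C a * X ^ n) := by
      rw [distMat_one, pow_succ', ← mul_assoc, mul_comm (C a) X, mul_assoc, map_mul, aeval_X]
    rw [hc, distMat_mul_apply]
    have hm : ∀ w ∈ Finset.univ.filter (fun w => G.dist y w = 1),
        G.dist w z ∈ Finset.range (G.diam + 1) := fun w _ =>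
      Finset.mem_range.2 (Nat.lt_succ_of_le (hG.dist_le w z))
    rw [← Finset.sum_fiberwise_of_maps_to hm]
    refine Finset.sum_congr rfl fun j hj => ?_
    rw [← hG.distCount_eq h1 (Nat.le_of_lt_succ (Finset.mem_range.1 hj)), distCount,
      Finset.filter_filter, Finset.sum_congr rfl (g := fun _ => e j), Finset.sum_const,
      nsmul_eq_mul]
    intro w hw
    rw [he, (Finset.mem_filter.1 hw).2.2]

theorem degree_eq (h1 : 1 ≤ G.diam) (y : V) : G.degree y = G.valency := by
  rw [← hG.card_dist_one h1 y, ← G.card_neighborFinset_eq_degree]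
  congr 1
  ext z
  simp [dist_eq_one_iff_adj]

theorem valency_mem_spectrum (h1 : 1 ≤ G.diam) :
    (G.valency : ℝ) ∈ spectrum ℝ (G.adjMatrix ℝ) := by
  refine Matrix.mem_spectrum_iff_exists_mulVec.2 ⟨fun _ => 1, ?_, ?_⟩
  · intro h
    have := congrFun h hG.conn.nonempty.some
    simp at this
  · ext y
    rw [adjMatrix_mulVec_apply]
    simp [hG.degree_eq h1]

/-- Changing the sign of an eigenvector on one colour class negates the eigenvalue; the classes are
read off from the parity of the distance to a base vertex. -/
theorem neg_mem_spectrum {μ : ℝ} (hμ : μ ∈ spectrum ℝ (G.adjMatrix ℝ)) :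
    -μ ∈ spectrum ℝ (G.adjMatrix ℝ) := by
  obtain ⟨u, hu, h⟩ := Matrix.mem_spectrum_iff_exists_mulVec.1 hμ
  have x := hG.conn.nonempty.some
  refine Matrix.mem_spectrum_iff_exists_mulVec.2 ⟨fun y => (-1) ^ G.dist x y * u y, ?_, ?_⟩
  · intro h0
    refine hu (funext fun y => ?_)
    simpa using congrFun h0 y
  · ext y
    have hy := congrFun h y
    simp only [adjMatrix_mulVec_apply, Pi.smul_apply, smul_eq_mul] at hy ⊢
    rw [show -μ * ((-1) ^ G.dist x y * u y) = -(-1) ^ G.dist x y * (μ * u y) by ring, ← hy,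
      Finset.mul_sum]
    refine Finset.sum_congr rfl fun z hz => ?_
    have hd := hG.conn.dist_of_adj hG.bip ((G.mem_neighborFinset y z).1 hz) x
    rw [G.dist_comm (u := z), G.dist_comm (u := y)] at hd
    rcases hd with hd | hd
    · rw [hd, pow_succ]; ring
    · rw [← hd, pow_succ]; ring

/-- The Laplacian k - A is positive semidefinite. -/
theorem le_valency_of_mem_spectrum (h1 : 1 ≤ G.diam) {μ : ℝ}
    (hμ : μ ∈ spectrum ℝ (G.adjMatrix ℝ)) : μ ≤ G.valency := by
  obtain ⟨u, hu, h⟩ := Matrix.mem_spectrum_iff_exists_mulVec.1 hμ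
  have hl := (posSemidef_lapMatrix ℝ G).dotProduct_mulVec_nonneg u
  have hd : G.degMatrix ℝ = (G.valency : ℝ) • 1 := by
    ext y z
    simp [degMatrix, hG.degree_eq h1, Matrix.diagonal_apply, Matrix.one_apply]
  rw [lapMatrix, hd, Matrix.sub_mulVec, h, Matrix.smul_mulVec, Matrix.one_mulVec,
    ← sub_smul, dotProduct_smul, smul_eq_mul, star_trivial] at hl
  have hp : 0 < u ⬝ᵥ u := by
    have h2 := Matrix.dotProduct_star_self_pos_iff (v := u) |>.2 hu
    simpa using h2
  nlinarith [nonneg_of_mul_nonneg_left hl hp]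

theorem sq_le_valency_sq (h1 : 1 ≤ G.diam) {μ : ℝ}
    (hμ : μ ∈ spectrum ℝ (G.adjMatrix ℝ)) : μ ^ 2 ≤ (G.valency : ℝ) ^ 2 := by
  have a := hG.le_valency_of_mem_spectrum h1 hμ
  have b := hG.le_valency_of_mem_spectrum h1 (hG.neg_mem_spectrum hμ)
  exact sq_le_sq' (by linarith) a

end IsBipartiteDRG

variable (G) in
/-- The polynomial whose value at the adjacency matrix is `distSum i`. -/
noncomputable def distSumPoly : ℕ → ℝ[X]
  | 0 => 1
  | 1 => X
  | i + 2 => C ((G.drgC (i + 2) : ℝ)⁻¹) * (X * distSumPoly (i + 1) -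
      C (G.drgB (i + 2) : ℝ) * distSumPoly i)

theorem natDegree_distSumPoly_le (i : ℕ) : (G.distSumPoly i).natDegree ≤ i := by
  induction i using Nat.twoStepInduction with
  | zero => simp [distSumPoly]
  | one => simp [distSumPoly]
  | more i ih1 ih2 =>
    rw [distSumPoly]
    refine (natDegree_C_mul_le _ _).trans ((natDegree_sub_le _ _).trans (max_le ?_ ?_))
    · refine natDegree_mul_le.trans ?_
      rw [natDegree_X]
      omega
    · exact (natDegree_C_mul_le _ _).trans (by omega)

theorem eval_neg_distSumPoly (i : ℕ) (t : ℝ) :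
    (G.distSumPoly i).eval (-t) = (-1) ^ i * (G.distSumPoly i).eval t := by
  induction i using Nat.twoStepInduction with
  | zero => simp [distSumPoly]
  | one => simp [distSumPoly]
  | more i ih1 ih2 =>
    simp only [distSumPoly, eval_mul, eval_C, eval_sub, eval_X, ih1, ih2, pow_succ]
    ring

namespace IsBipartiteDRG

variable (hG : G.IsBipartiteDRG)
include hG

theorem aeval_distSumPoly (h1 : 1 ≤ G.diam) {i : ℕ} (hi : i ≤ G.diam) :
    aeval (G.adjMatrix ℝ) (G.distSumPoly i) = G.distSum ℝ i := by
  induction i using Nat.twoStepInduction with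
  | zero => simp [distSumPoly, distSum, hG.distMat_zero]
  | one => simp [distSumPoly, distSum, distMat_one]
  | more i ih1 ih2 =>
    have e := hG.distMat_one_mul_distSum_succ (R := ℝ) h1 i
    have hc : (G.drgC (i + 2) : ℝ) ≠ 0 := by
      have := hG.drgC_pos (i := i + 2) (by omega) hi
      positivity
    rw [distSumPoly, map_mul, map_sub, map_mul, map_mul, aeval_X, ih1 (by omega),
      ih2 (by omega), ← distMat_one, e, aeval_C, aeval_C, Algebra.algebraMap_eq_smul_one,
      Algebra.algebraMap_eq_smul_one, smul_mul_assoc, smul_mul_assoc, one_mul, one_mul, distSum,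
      ← hG.drgC_add_drgB h1 hi]
    push_cast
    rw [show ((G.drgC (i + 2) : ℝ) + G.drgB (i + 2)) • G.distSum ℝ i
      + (G.drgC (i + 2) : ℝ) • G.distMat ℝ (i + 2) - (G.drgB (i + 2) : ℝ) • G.distSum ℝ i
      = (G.drgC (i + 2) : ℝ) • (G.distSum ℝ i + G.distMat ℝ (i + 2)) by module, smul_smul,
      inv_mul_cancel₀ hc, one_smul]

theorem aeval_valency_sq_sub_mul (h1 : 1 ≤ G.diam) {i : ℕ} (hi : i ≤ G.diam) :
    aeval (G.adjMatrix ℝ) ((C ((G.valency : ℝ) ^ 2) - X ^ 2) * G.distSumPoly i)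
      = ((G.drgB i : ℝ) * G.drgB (i + 1)) • G.distMat ℝ i
        - ((G.drgC (i + 1) : ℝ) * G.drgC (i + 2)) • G.distMat ℝ (i + 2) := by
  rw [← hG.valency_sq_sub_mul_distSum h1, map_mul, hG.aeval_distSumPoly h1 hi, map_sub,
    aeval_C, Algebra.algebraMap_eq_smul_one, map_pow, aeval_X, sub_mul, smul_mul_assoc, one_mul,
    distMat_one, pow_two (G.adjMatrix ℝ), mul_assoc]

theorem aeval_valency_sq_sub_mul_ne_zero (h1 : 1 ≤ G.diam) {i : ℕ} (hi : i + 2 ≤ G.diam) :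
    aeval (G.adjMatrix ℝ) ((C ((G.valency : ℝ) ^ 2) - X ^ 2) * G.distSumPoly i) ≠ 0 := by
  obtain ⟨y, z, hyz⟩ := hG.drg.exists_dist_eq hi
  intro h
  have h2 := congrFun (congrFun h y) z
  have c1 := hG.drgC_pos (i := i + 1) (by omega) (by omega)
  have c2 := hG.drgC_pos (i := i + 2) (by omega) (by omega)
  rw [hG.aeval_valency_sq_sub_mul h1 (by omega)] at h2
  simp [distMat_apply, hyz] at h2
  omega

/-- An annihilating polynomial of degree at most D + 1 bounds the number from above; the product of
X - μ over the spectrum annihilates A, so its degree exceeds D. -/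
theorem card_spectrum (h1 : 1 ≤ G.diam) :
    (Matrix.finite_real_spectrum (A := G.adjMatrix ℝ)).toFinset.card = G.diam + 1 := by
  set S := (Matrix.finite_real_spectrum (A := G.adjMatrix ℝ)).toFinset with hS
  have hmem : ∀ μ, μ ∈ S ↔ μ ∈ spectrum ℝ (G.adjMatrix ℝ) := fun μ => by simp [hS]
  apply le_antisymm
  -- By the Christoffel-type identity g(A) is a combination with a factor b_D = 0 in one term and
  -- the matrix A_{D+1} = 0 in the other.
  · set g : ℝ[X] := (C ((G.valency : ℝ) ^ 2) - X ^ 2) * G.distSumPoly (G.diam - 1) with hg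
    have hz : aeval (G.adjMatrix ℝ) g = 0 := by
      rw [hg, hG.aeval_valency_sq_sub_mul h1 (by omega),
        hG.drgB_diam (i := G.diam - 1 + 1) (by omega),
        hG.distMat_eq_zero (i := G.diam - 1 + 2) (by omega)]
      simp
    have hq : G.distSumPoly (G.diam - 1) ≠ 0 := by
      intro h
      have h2 := hG.aeval_distSumPoly h1 (i := G.diam - 1) (by omega)
      obtain ⟨y, z, hyz⟩ := hG.drg.exists_dist_eq (i := G.diam - 1) (by omega)
      have h3 := congrFun (congrFun h2 y) z
      rw [h, distSum_apply_self hyz] at h3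
      simp at h3
    have hk : (C ((G.valency : ℝ) ^ 2) - X ^ 2 : ℝ[X]).natDegree ≤ 2 := by
      refine (natDegree_sub_le _ _).trans ?_
      simp
    have hk0 : (C ((G.valency : ℝ) ^ 2) - X ^ 2 : ℝ[X]) ≠ 0 := by
      intro h
      have := congrArg (fun p => p.eval ((G.valency : ℝ) + 1)) h
      simp only [eval_sub, eval_C, eval_pow, eval_X, eval_zero] at this
      nlinarith [Nat.cast_nonneg (α := ℝ) G.valency]
    have hsub : S ⊆ g.roots.toFinset := fun μ hμ => by
      rw [Multiset.mem_toFinset, mem_roots (mul_ne_zero hk0 hq)]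
      exact (isHermitian_adjMatrix_real.aeval_eq_zero_iff.1 hz) μ ((hmem μ).1 hμ)
    calc S.card ≤ g.roots.toFinset.card := Finset.card_le_card hsub
      _ ≤ Multiset.card g.roots := Multiset.toFinset_card_le _
      _ ≤ g.natDegree := card_roots' g
      _ ≤ 2 + (G.diam - 1) :=
        natDegree_mul_le.trans (add_le_add hk (natDegree_distSumPoly_le _))
      _ = G.diam + 1 := by omega
  · have hm : (∏ μ ∈ S, (X - C μ)).Monic := monic_prod_of_monic _ _ fun μ _ => monic_X_sub_C μ
    have := hG.natDegree_gt_of_aeval_eq_zero hm.ne_zero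
      (isHermitian_adjMatrix_real.aeval_eq_zero_iff.2 fun μ hμ => by
        rw [eval_prod]
        exact Finset.prod_eq_zero ((hmem μ).2 hμ) (by simp))
    rw [natDegree_prod_of_monic _ _ (fun μ _ => monic_X_sub_C μ)] at this
    simp at this
    omega

end IsBipartiteDRG

end Spectrum

end SimpleGraph

namespace SimpleGraph

/-! ### Ordered eigenvalues, extremality of θ_1² and θ_d², and cosine sequences. -/

section Theta

open Polynomial

variable {V : Type*} [Fintype V] [DecidableEq V] {G : SimpleGraph V} [DecidableRel G.Adj]

theorem mem_eigenvalueList {μ : ℝ} :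
    μ ∈ G.eigenvalueList ↔ μ ∈ spectrum ℝ (G.adjMatrix ℝ) := by
  simp [eigenvalueList]

theorem sortedGT_eigenvalueList : G.eigenvalueList.SortedGT := Finset.sortedGT_sort _

namespace IsBipartiteDRG

variable (hG : G.IsBipartiteDRG)
include hG

theorem length_eigenvalueList (h1 : 1 ≤ G.diam) : G.eigenvalueList.length = G.diam + 1 := by
  rw [eigenvalueList, Finset.length_sort, hG.card_spectrum h1]

theorem eigenvalueList_reverse_map_neg :
    (G.eigenvalueList.map fun t => -t).reverse = G.eigenvalueList := by
  refine List.SortedGT.eq_of_mem_iff ?_ sortedGT_eigenvalueList fun μ => ?_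
  · rw [List.sortedGT_iff_pairwise, List.pairwise_reverse, List.pairwise_map]
    have := (sortedGT_eigenvalueList (G := G)).pairwise
    exact this.imp fun h => neg_lt_neg h
  · simp only [List.mem_reverse, List.mem_map, mem_eigenvalueList]
    constructor
    · rintro ⟨t, ht, rfl⟩
      exact hG.neg_mem_spectrum ht
    · intro h
      exact ⟨-μ, hG.neg_mem_spectrum h, neg_neg μ⟩

/-- Negation reverses the ordered spectrum. -/
theorem theta_sub (h1 : 1 ≤ G.diam) {i : ℕ} (hi : i ≤ G.diam) :
    G.theta (G.diam - i) = -G.theta i := by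
  have hl := hG.length_eigenvalueList h1
  have hlt : G.diam - i < G.eigenvalueList.length := by omega
  have h : (G.eigenvalueList.map fun t => -t).reverse[G.diam - i]'(by simpa using hlt)
      = G.eigenvalueList[G.diam - i]'hlt :=
    List.getElem_of_eq hG.eigenvalueList_reverse_map_neg _
  rw [theta, theta, List.getD_eq_getElem _ _ hlt,
    List.getD_eq_getElem _ _ (show i < G.eigenvalueList.length by omega), ← h,
    List.getElem_reverse, List.getElem_map]
  congr 2
  simp only [List.length_map]
  omega

theorem theta_mem (h1 : 1 ≤ G.diam) {i : ℕ} (hi : i ≤ G.diam) :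
    G.theta i ∈ spectrum ℝ (G.adjMatrix ℝ) := by
  have hl := hG.length_eigenvalueList h1
  rw [theta, List.getD_eq_getElem _ _ (show i < G.eigenvalueList.length by omega),
    ← mem_eigenvalueList]
  exact List.getElem_mem _

theorem exists_theta_eq (h1 : 1 ≤ G.diam) {μ : ℝ} (h : μ ∈ spectrum ℝ (G.adjMatrix ℝ)) :
    ∃ i ≤ G.diam, G.theta i = μ := by
  obtain ⟨i, hi, rfl⟩ := List.getElem_of_mem (mem_eigenvalueList.2 h)
  have hl := hG.length_eigenvalueList h1
  exact ⟨i, by omega, by rw [theta, List.getD_eq_getElem _ _ hi]⟩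

theorem theta_lt (h1 : 1 ≤ G.diam) {i j : ℕ} (hij : i < j) (hj : j ≤ G.diam) :
    G.theta j < G.theta i := by
  have hl := hG.length_eigenvalueList h1
  rw [theta, theta, List.getD_eq_getElem _ _ (show i < G.eigenvalueList.length by omega),
    List.getD_eq_getElem _ _ (show j < G.eigenvalueList.length by omega)]
  exact sortedGT_eigenvalueList.getElem_lt_getElem_iff.2 hij

theorem theta_le (h1 : 1 ≤ G.diam) {i j : ℕ} (hij : i ≤ j) (hj : j ≤ G.diam) :
    G.theta j ≤ G.theta i := by
  rcases hij.eq_or_lt with rfl | h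
  · exact le_rfl
  · exact (hG.theta_lt h1 h hj).le

theorem theta_zero (h1 : 1 ≤ G.diam) : G.theta 0 = G.valency := by
  apply le_antisymm (hG.le_valency_of_mem_spectrum h1 (hG.theta_mem h1 (Nat.zero_le _)))
  obtain ⟨i, hi, h⟩ := hG.exists_theta_eq h1 (hG.valency_mem_spectrum h1)
  rw [← h]
  exact hG.theta_le h1 (Nat.zero_le _) hi

/-- For odd D the indices d and D - d are distinct, so θ_d > θ_{D-d} = -θ_d. -/
theorem theta_half_pos (h1 : 1 ≤ G.diam) (hodd : Odd G.diam) : 0 < G.theta (G.diam / 2) := by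
  obtain ⟨m, hm⟩ := hodd
  have h := hG.theta_sub h1 (i := G.diam / 2) (by omega)
  have h' := hG.theta_lt h1 (i := G.diam / 2) (j := G.diam - G.diam / 2) (by omega) (by omega)
  linarith

theorem theta_sq_lt (h1 : 1 ≤ G.diam) (hodd : Odd G.diam) {i : ℕ} (h0 : 1 ≤ i)
    (hi : i ≤ G.diam / 2) : G.theta i ^ 2 < (G.valency : ℝ) ^ 2 := by
  have a := hG.theta_half_pos h1 hodd
  have b := hG.theta_le h1 hi (by omega)
  have c := hG.theta_lt h1 (i := 0) (j := i) h0 (by omega)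
  rw [hG.theta_zero h1] at c
  nlinarith

/-- By the symmetry θ_{D-i} = -θ_i only indices i ≤ d matter, and there all eigenvalues are positive
because D is odd, so squaring preserves their order. -/
theorem sq_mem_Icc (h1 : 1 ≤ G.diam) (hodd : Odd G.diam) {μ : ℝ}
    (h : μ ∈ spectrum ℝ (G.adjMatrix ℝ)) : μ ^ 2 = (G.valency : ℝ) ^ 2 ∨
      G.theta (G.diam / 2) ^ 2 ≤ μ ^ 2 ∧ μ ^ 2 ≤ G.theta 1 ^ 2 := by
  have a := hG.theta_half_pos h1 hodd
  have key : ∀ i ≤ G.diam / 2, G.theta i ^ 2 = (G.valency : ℝ) ^ 2 ∨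
      G.theta (G.diam / 2) ^ 2 ≤ G.theta i ^ 2 ∧ G.theta i ^ 2 ≤ G.theta 1 ^ 2 := fun i hi => by
    rcases Nat.eq_zero_or_pos i with rfl | h0
    · left
      rw [hG.theta_zero h1]
    · right
      have b := hG.theta_le h1 hi (by omega)
      have c := hG.theta_le h1 (i := 1) (j := i) h0 (by omega)
      exact ⟨by nlinarith, by nlinarith⟩
  obtain ⟨i, hi, rfl⟩ := hG.exists_theta_eq h1 h
  rcases le_or_gt i (G.diam / 2) with h2 | h2
  · exact key i h2
  · have h3 := hG.theta_sub h1 hi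
    have h4 := key (G.diam - i) (by obtain ⟨m, hm⟩ := hodd; omega)
    rw [h3, neg_sq] at h4
    exact h4

/-- On the spectrum k² - μ² is nonnegative, and it vanishes where the sign of g is not controlled.
The product is thus nonnegative on the spectrum, so zero trace makes it vanish there. -/
theorem valency_sq_sub_mul_eval_nonneg {g : ℝ[X]} (h1 : 1 ≤ G.diam)
    (hg : ∀ μ ∈ spectrum ℝ (G.adjMatrix ℝ), μ ^ 2 = (G.valency : ℝ) ^ 2 ∨ 0 ≤ g.eval μ)
    (ht : (aeval (G.adjMatrix ℝ) ((C ((G.valency : ℝ) ^ 2) - X ^ 2) * g)).trace = 0) :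
    aeval (G.adjMatrix ℝ) ((C ((G.valency : ℝ) ^ 2) - X ^ 2) * g) = 0 := by
  refine isHermitian_adjMatrix_real.aeval_eq_zero_iff.2 ?_
  refine isHermitian_adjMatrix_real.eval_eq_zero_of_trace_aeval_eq_zero (fun μ hμ => ?_) ht
  have h2 := hG.sq_le_valency_sq h1 hμ
  simp only [eval_mul, eval_sub, eval_C, eval_pow, eval_X]
  rcases hg μ hμ with h | h
  · rw [h]; simp
  · exact mul_nonneg (by linarith) h

theorem trace_distMat (i : ℕ) (hi : 1 ≤ i) : (G.distMat ℝ i).trace = 0 := by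
  simp only [Matrix.trace, Matrix.diag_apply, distMat_apply, dist_self]
  exact Finset.sum_eq_zero fun _ _ => if_neg (by omega)

/-- If every nontrivial eigenvalue `μ` satisfied `ε (μ² - b₂) ≥ 0`, the matrix
`(k² - A²)(A² - b₂)` would vanish. -/
theorem exists_mul_sq_sub_neg (h4 : 4 ≤ G.diam) {ε : ℝ} (hε : ε ≠ 0) :
    ∃ μ ∈ spectrum ℝ (G.adjMatrix ℝ), μ ^ 2 ≠ (G.valency : ℝ) ^ 2 ∧
      ε * (μ ^ 2 - G.drgB 2) < 0 := by
  by_contra! hcon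
  have hc : (G.drgC 2 : ℝ) ≠ 0 := by
    have := hG.drgC_pos (i := 2) (by omega) (by omega)
    positivity
  -- Since Q_2 = (A² - b_2)/c_2, the Christoffel-type identity for i = 2 applies to (k² - A²)(A² -
  -- b_2); it leaves only A_2 and A_4, which have zero trace.
  have hev : ∀ μ : ℝ, (C (ε * G.drgC 2) * G.distSumPoly 2).eval μ
      = ε * (μ ^ 2 - G.drgB 2) := fun μ => by
    simp only [distSumPoly, zero_add, eval_mul, eval_C, eval_sub, eval_X, eval_one]
    field_simp
  have hm : aeval (G.adjMatrix ℝ) ((C ((G.valency : ℝ) ^ 2) - X ^ 2) *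
      (C (ε * G.drgC 2) * G.distSumPoly 2)) = (ε * G.drgC 2) •
      aeval (G.adjMatrix ℝ) ((C ((G.valency : ℝ) ^ 2) - X ^ 2) * G.distSumPoly 2) := by
    rw [show (C ((G.valency : ℝ) ^ 2) - X ^ 2 : ℝ[X]) * (C (ε * G.drgC 2) * G.distSumPoly 2)
      = C (ε * G.drgC 2) * ((C ((G.valency : ℝ) ^ 2) - X ^ 2) * G.distSumPoly 2) by ring,
      map_mul, aeval_C, Algebra.algebraMap_eq_smul_one, smul_mul_assoc, one_mul]
  have h := hG.valency_sq_sub_mul_eval_nonneg (g := C (ε * G.drgC 2) * G.distSumPoly 2)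
    (by omega) (fun μ hμ => by
      rw [hev]
      by_cases h : μ ^ 2 = (G.valency : ℝ) ^ 2
      · exact Or.inl h
      · exact Or.inr (hcon μ hμ h)) (by
      rw [hm, hG.aeval_valency_sq_sub_mul (by omega) (by omega), Matrix.trace_smul,
        Matrix.trace_sub, Matrix.trace_smul, Matrix.trace_smul, hG.trace_distMat _ (by omega),
        hG.trace_distMat _ (by omega)]
      simp)
  rw [hm] at h
  exact hG.aeval_valency_sq_sub_mul_ne_zero (by omega) (i := 2) (by omega)
    ((smul_eq_zero.1 h).resolve_left (mul_ne_zero hε hc))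

theorem drgB_two_lt_theta_one_sq (h4 : 4 ≤ G.diam) (hodd : Odd G.diam) :
    (G.drgB 2 : ℝ) < G.theta 1 ^ 2 := by
  obtain ⟨μ, hμ, h, hlt⟩ := hG.exists_mul_sq_sub_neg h4 (ε := -1) (by norm_num)
  have := ((hG.sq_mem_Icc (by omega) hodd hμ).resolve_left h).2
  linarith

theorem theta_half_sq_lt_drgB_two (h4 : 4 ≤ G.diam) (hodd : Odd G.diam) :
    G.theta (G.diam / 2) ^ 2 < G.drgB 2 := by
  obtain ⟨μ, hμ, h, hlt⟩ := hG.exists_mul_sq_sub_neg h4 (ε := 1) (by norm_num)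
  have := ((hG.sq_mem_Icc (by omega) hodd hμ).resolve_left h).1
  linarith

/-- A positive semidefinite matrix in the Bose-Mesner algebra with `A E = θ E`. -/
theorem exists_gram_eigenmatrix {θ : ℝ} (hθ : θ ∈ spectrum ℝ (G.adjMatrix ℝ)) :
    ∃ (F : Matrix V V ℝ) (e : ℕ → ℝ), (∀ y z, (Fᵀ * F) y z = e (G.dist y z)) ∧ 0 < e 0 ∧
      G.adjMatrix ℝ * (Fᵀ * F) = θ • (Fᵀ * F) := by
  set S := (Matrix.finite_real_spectrum (A := G.adjMatrix ℝ)).toFinset with hS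
  have hmem : ∀ μ, μ ∈ S ↔ μ ∈ spectrum ℝ (G.adjMatrix ℝ) := fun μ => by simp [hS]
  -- Up to a nonzero scalar, g(A) is the primitive idempotent of θ.
  set g : ℝ[X] := ∏ μ ∈ S.erase θ, (X - C μ) with hg
  set F := aeval (G.adjMatrix ℝ) g with hF
  have hsymm : Fᵀ = F := by
    rw [hF, aeval_eq_sum_range, Matrix.transpose_sum]
    refine Finset.sum_congr rfl fun n _ => ?_
    rw [Matrix.transpose_smul, Matrix.transpose_pow, transpose_adjMatrix]
  have hAF : G.adjMatrix ℝ * F = θ • F := by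
    have h0 : aeval (G.adjMatrix ℝ) ((X - C θ) * g) = 0 := by
      refine isHermitian_adjMatrix_real.aeval_eq_zero_iff.2 fun μ hμ => ?_
      rw [hg, Finset.mul_prod_erase S (fun μ => (X - C μ)) ((hmem θ).2 hθ), eval_prod]
      exact Finset.prod_eq_zero ((hmem μ).2 hμ) (by simp)
    rw [map_mul, map_sub, aeval_X, aeval_C, Algebra.algebraMap_eq_smul_one, sub_mul,
      smul_mul_assoc, one_mul] at h0
    exact sub_eq_zero.1 h0
  have hF0 : F ≠ 0 := fun h => by
    have h2 := isHermitian_adjMatrix_real.aeval_eq_zero_iff.1 h θ hθ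
    rw [hg, eval_prod, Finset.prod_eq_zero_iff] at h2
    obtain ⟨μ, hμ, h3⟩ := h2
    rw [eval_sub, eval_X, eval_C, sub_eq_zero] at h3
    exact (Finset.mem_erase.1 hμ).1 h3.symm
  obtain ⟨e, he⟩ := hG.exists_aeval_apply_eq (g * g)
  have he' : ∀ y z, (Fᵀ * F) y z = e (G.dist y z) := fun y z => by
    rw [hsymm, hF, ← map_mul, he]
  refine ⟨F, e, he', ?_, ?_⟩
  · have hd : ∀ y, e 0 = ∑ w, F w y ^ 2 := fun y => by
      rw [← G.dist_self (v := y), ← he', Matrix.mul_apply]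
      exact Finset.sum_congr rfl fun w _ => by rw [Matrix.transpose_apply, sq]
    have hex : ∃ w y, F w y ≠ 0 := by
      by_contra! h
      exact hF0 (by ext w y; exact h w y)
    obtain ⟨w, y, hwy⟩ := hex
    rw [hd y]
    exact Finset.sum_pos' (fun _ _ => sq_nonneg _) ⟨w, Finset.mem_univ _, by positivity⟩
  · rw [hsymm, ← mul_assoc, hAF, smul_mul_assoc]

theorem trace_mul_distMat {E : Matrix V V ℝ} {e : ℕ → ℝ} (he : ∀ y z, E y z = e (G.dist y z))
    (i : ℕ) : (E * G.distMat ℝ i).trace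
      = e i * (G.distMat ℝ i * G.distMat ℝ i).trace := by
  simp only [Matrix.trace, Matrix.diag_apply, Matrix.mul_apply, distMat_apply, he,
    Finset.mul_sum]
  refine Finset.sum_congr rfl fun y _ => Finset.sum_congr rfl fun z _ => ?_
  rw [G.dist_comm (u := z)]
  split_ifs with h <;> simp [h]

theorem trace_mul_aeval_of_natDegree_lt {g : ℝ[X]} {i : ℕ} (hg : g.natDegree < i) :
    (G.distMat ℝ i * aeval (G.adjMatrix ℝ) g).trace = 0 := by
  simp only [Matrix.trace, Matrix.diag_apply, distMat_mul_apply]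
  refine Finset.sum_eq_zero fun y _ => Finset.sum_eq_zero fun w hw => ?_
  refine aeval_adjMatrix_apply_of_lt_dist ?_
  rw [G.dist_comm, (Finset.mem_filter.1 hw).2]
  exact hg

/-- The argument is the classical one for zeros of orthogonal polynomials. If θ were a zero, parity
would give Q_i = (X² - θ²)q with q of degree less than i. By the Christoffel-type identity (k² -
A²)Q_i is a combination of A_i and A_{i+2}, hence trace-orthogonal to q(A). But (k² - μ²)(μ² -
θ²)q(μ)² has constant sign on the spectrum, so (k² - A²)Q_i would vanish. -/
theorem eval_distSumPoly_ne_zero (h1 : 1 ≤ G.diam) {θ ε : ℝ} (hθ : θ ≠ 0) (hε : ε ≠ 0)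
    (hs : ∀ μ ∈ spectrum ℝ (G.adjMatrix ℝ), μ ^ 2 = (G.valency : ℝ) ^ 2 ∨
      0 ≤ ε * (μ ^ 2 - θ ^ 2)) {i : ℕ} (hi : i + 2 ≤ G.diam) :
    (G.distSumPoly i).eval θ ≠ 0 := by
  intro h0
  obtain ⟨r, hr⟩ := dvd_iff_isRoot.2 h0
  have h0' : r.eval (-θ) = 0 := by
    have h2 := eval_neg_distSumPoly (G := G) i θ
    rw [h0, mul_zero, hr, eval_mul, eval_sub, eval_X, eval_C] at h2
    refine (mul_eq_zero.1 h2).resolve_left ?_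
    intro h3
    exact hθ (by linarith)
  obtain ⟨q, hq⟩ := dvd_iff_isRoot.2 h0'
  rw [hq, ← mul_assoc] at hr
  have hpne : G.distSumPoly i ≠ 0 := fun h => by
    refine hG.aeval_valency_sq_sub_mul_ne_zero h1 hi ?_
    rw [h, mul_zero, map_zero]
  have hq0 : q ≠ 0 := by
    rintro rfl
    exact hpne (by rw [hr, mul_zero])
  have hdeg : q.natDegree < i := by
    have h2 := natDegree_distSumPoly_le (G := G) i
    rw [hr, natDegree_mul (mul_ne_zero (X_sub_C_ne_zero _) (X_sub_C_ne_zero _)) hq0,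
      natDegree_mul (X_sub_C_ne_zero _) (X_sub_C_ne_zero _), natDegree_X_sub_C,
      natDegree_X_sub_C] at h2
    omega
  have hpe : ∀ μ : ℝ, (G.distSumPoly i).eval μ = (μ ^ 2 - θ ^ 2) * q.eval μ := fun μ => by
    rw [hr]
    simp only [eval_mul, eval_sub, eval_X, eval_C]
    ring
  have hz := hG.valency_sq_sub_mul_eval_nonneg (g := C ε * (G.distSumPoly i * q)) h1
    (fun μ hμ => by
      rcases hs μ hμ with h | h
      · exact Or.inl h
      · right
        simp only [eval_mul, eval_C, hpe]
        nlinarith [mul_nonneg h (sq_nonneg (q.eval μ))])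
    (by
      rw [show (C ((G.valency : ℝ) ^ 2) - X ^ 2 : ℝ[X]) * (C ε * (G.distSumPoly i * q))
        = ((C ((G.valency : ℝ) ^ 2) - X ^ 2) * G.distSumPoly i) * (C ε * q) by ring, map_mul,
        hG.aeval_valency_sq_sub_mul h1 (by omega), sub_mul, smul_mul_assoc, smul_mul_assoc,
        Matrix.trace_sub, Matrix.trace_smul, Matrix.trace_smul,
        hG.trace_mul_aeval_of_natDegree_lt ((natDegree_C_mul_le _ _).trans_lt hdeg),
        hG.trace_mul_aeval_of_natDegree_lt ((natDegree_C_mul_le _ _).trans_lt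
          (hdeg.trans (by omega : i < i + 2)))]
      simp)
  refine hG.aeval_valency_sq_sub_mul_ne_zero h1 hi ?_
  rw [isHermitian_adjMatrix_real.aeval_eq_zero_iff] at hz ⊢
  intro μ hμ
  have h2 := hz μ hμ
  simp only [eval_mul, eval_C, hpe] at h2 ⊢
  rcases mul_eq_zero.1 h2 with h3 | h3
  · rw [h3, zero_mul]
  · rcases mul_eq_zero.1 ((mul_eq_zero.1 h3).resolve_left hε) with h4 | h4
    · rw [h4, mul_zero]
    · rw [h4, mul_zero, mul_zero]

/-- The cosines of an eigenvalue `θ` with `θ²` extremal satisfy `e_i ≠ e_{i+2}`. -/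
theorem cosine_ne (h1 : 1 ≤ G.diam) {θ ε : ℝ} (hθ : θ ≠ 0) (hε : ε ≠ 0)
    (hk : θ ^ 2 ≠ (G.valency : ℝ) ^ 2)
    (hs : ∀ μ ∈ spectrum ℝ (G.adjMatrix ℝ), μ ^ 2 = (G.valency : ℝ) ^ 2 ∨
      0 ≤ ε * (μ ^ 2 - θ ^ 2)) {E : Matrix V V ℝ} {e : ℕ → ℝ}
    (he : ∀ y z, E y z = e (G.dist y z)) (he0 : 0 < e 0)
    (hE : G.adjMatrix ℝ * E = θ • E) {i : ℕ} (hi : i + 2 ≤ G.diam) : e i ≠ e (i + 2) := by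
  intro heq
  have hp := hG.eval_distSumPoly_ne_zero h1 hθ hε hs hi
  -- This trace is (k² - θ²)Q_i(θ) tr E. Expanded in A_i and A_{i+2}, it is proportional to e_i -
  -- e_{i+2}, because `drgB_mul_trace` at i and i + 1 makes the two coefficients equal.
  have ht : (aeval (G.adjMatrix ℝ) ((C ((G.valency : ℝ) ^ 2) - X ^ 2) * G.distSumPoly i)
      * E).trace = 0 := by
    rw [hG.aeval_valency_sq_sub_mul h1 (by omega), Matrix.trace_mul_comm, mul_sub,
      Matrix.trace_sub, mul_smul_comm, mul_smul_comm, Matrix.trace_smul, Matrix.trace_smul,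
      hG.trace_mul_distMat he, hG.trace_mul_distMat he, heq]
    have e1 := hG.drgB_mul_trace (R := ℝ) h1 i
    have e2 := hG.drgB_mul_trace (R := ℝ) h1 (i + 1)
    simp only [smul_eq_mul]
    linear_combination e (i + 2) * (G.drgB (i + 1) : ℝ) * e1
      + e (i + 2) * (G.drgC (i + 1) : ℝ) * e2
  rw [Matrix.aeval_mul_of_mul_eq hE, Matrix.trace_smul] at ht
  have hE0 : E.trace ≠ 0 := by
    have : E.trace = ∑ _y : V, e 0 := Finset.sum_congr rfl fun y _ => by
      rw [Matrix.diag_apply, he, dist_self]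
    rw [this, Finset.sum_const, nsmul_eq_mul]
    have := hG.conn.nonempty
    have hc : (0 : ℝ) < (Finset.univ : Finset V).card :=
      Nat.cast_pos.2 (Finset.card_pos.2 Finset.univ_nonempty)
    positivity
  rw [smul_eq_mul, eval_mul, eval_sub, eval_C, eval_pow, eval_X] at ht
  rcases mul_eq_zero.1 ht with h | h
  · rcases mul_eq_zero.1 h with h | h
    · exact hk (by linarith)
    · exact hp h
  · exact hE0 h

/-- The cosine recurrence. -/
theorem cosine_recurrence (h1 : 1 ≤ G.diam) {θ : ℝ} {E : Matrix V V ℝ} {e : ℕ → ℝ}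
    (he : ∀ y z, E y z = e (G.dist y z)) (hE : G.adjMatrix ℝ * E = θ • E) {i : ℕ}
    (hi : i ≤ G.diam) :
    (G.drgC i : ℝ) * e (i - 1) + G.drgB i * e (i + 1) = θ * e i := by
  obtain ⟨y, z, rfl⟩ := hG.drg.exists_dist_eq hi
  have h := congrFun (congrFun hE y) z
  rw [← distMat_one, distMat_mul_apply, Matrix.smul_apply, he, smul_eq_mul] at h
  rw [← h]
  have hs : ∀ w ∈ Finset.univ.filter (fun w => G.dist y w = 1), E w z
      = (if G.dist w z + 1 = G.dist y z then e (G.dist y z - 1) else 0)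
        + (if G.dist w z = G.dist y z + 1 then e (G.dist y z + 1) else 0) := fun w hw => by
    have hd := hG.conn.dist_of_adj hG.bip
      (dist_eq_one_iff_adj.1 (Finset.mem_filter.1 hw).2) z
    rw [he]
    rcases hd with hd | hd
    · rw [if_neg (by omega), if_pos hd, zero_add, hd]
    · rw [if_pos hd, if_neg (by omega), add_zero, ← hd, Nat.add_sub_cancel]
  rw [Finset.sum_congr rfl hs, Finset.sum_add_distrib, ← Finset.sum_filter,
    ← Finset.sum_filter, Finset.filter_filter, Finset.filter_filter, Finset.sum_const,
    Finset.sum_const, nsmul_eq_mul, nsmul_eq_mul]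
  congr 2
  · rcases Nat.eq_zero_or_pos (G.dist y z) with h0 | h0
    · rw [h0, hG.drgC_zero, eq_comm, Nat.cast_inj, Finset.card_eq_zero,
        Finset.filter_eq_empty_iff]
      omega
    · rw [drgC, ← hG.distCount_eq h1 (by omega), distCount, Nat.cast_inj]
      congr 1
      ext w
      simp only [Finset.mem_filter, Finset.mem_univ, true_and]
      omega
  · rcases hi.lt_or_eq with hlt | heq
    · rw [drgB, ← hG.distCount_eq h1 hlt, distCount]
    · rw [hG.drgB_diam heq.ge, eq_comm, Nat.cast_inj, Finset.card_eq_zero,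
        Finset.filter_eq_empty_iff]
      rintro w - ⟨-, hw⟩
      have := hG.dist_le w z
      omega

end IsBipartiteDRG

end Theta

end SimpleGraph

namespace SimpleGraph

/-! ### Products and traces of the local matrices B, N and E_2^* J E_2^*. -/

section Local

variable {V : Type*} [Fintype V] [DecidableEq V] {G : SimpleGraph V}

variable (V) in
/-- The all-ones matrix. -/
def onesMat : Matrix V V ℂ := Matrix.of fun _ _ => 1

omit [Fintype V] [DecidableEq V] in
theorem onesMat_apply (y z : V) : onesMat V y z = 1 := rfl

omit [Fintype V] [DecidableEq V] in
theorem onesMat_conjTranspose : (onesMat V)ᴴ = onesMat V := by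
  ext; simp [onesMat_apply]

omit [Fintype V] [DecidableEq V] in
theorem distMat_conjTranspose (i : ℕ) : (G.distMat ℂ i)ᴴ = G.distMat ℂ i := by
  ext y z
  simp only [Matrix.conjTranspose_apply, distMat_apply, G.dist_comm (u := z)]
  split_ifs <;> simp

variable (x : V)

omit [Fintype V] in
theorem dualIdem_conjTranspose (i : ℕ) : (G.dualIdem x i)ᴴ = G.dualIdem x i := by
  rw [dualIdem, Matrix.diagonal_conjTranspose]
  congr 1
  ext y
  simp only [Pi.star_apply]
  split_ifs <;> simp

theorem dualIdem_mul_apply (i : ℕ) (M : Matrix V V ℂ) (y z : V) :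
    (G.dualIdem x i * M) y z = if G.dist x y = i then M y z else 0 := by
  simp [dualIdem, Matrix.diagonal_mul]

theorem mul_dualIdem_apply (i : ℕ) (M : Matrix V V ℂ) (y z : V) :
    (M * G.dualIdem x i) y z = if G.dist x z = i then M y z else 0 := by
  simp [dualIdem, Matrix.mul_diagonal]

theorem dualIdem_mul_self (i : ℕ) : G.dualIdem x i * G.dualIdem x i = G.dualIdem x i := by
  ext y z
  rw [dualIdem_mul_apply]
  simp only [dualIdem, Matrix.diagonal_apply]
  split_ifs <;> rfl

theorem dualIdem_mul_self_assoc (i : ℕ) (M : Matrix V V ℂ) :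
    G.dualIdem x i * (G.dualIdem x i * M) = G.dualIdem x i * M := by
  rw [← mul_assoc, dualIdem_mul_self]

theorem sandwich_ext {i h : ℕ} {M N : Matrix V V ℂ}
    (H : ∀ y z, G.dist x y = i → G.dist x z = h → M y z = N y z) :
    G.dualIdem x i * M * G.dualIdem x h = G.dualIdem x i * N * G.dualIdem x h := by
  ext y z
  rw [mul_dualIdem_apply, mul_dualIdem_apply, dualIdem_mul_apply, dualIdem_mul_apply]
  split_ifs with h1 h2
  · exact H y z h2 h1
  all_goals rfl

variable (G)

/-- The matrix `E₂* A₂ E₂*`. -/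
noncomputable def locB : Matrix V V ℂ := G.dualIdem x 2 * G.distMat ℂ 2 * G.dualIdem x 2

/-- The matrix `E₂* A E₁*`. -/
noncomputable def locN : Matrix V V ℂ := G.dualIdem x 2 * G.distMat ℂ 1 * G.dualIdem x 1

/-- The matrix `E₂* J E₂*`. -/
noncomputable def locJ : Matrix V V ℂ := G.dualIdem x 2 * onesMat V * G.dualIdem x 2

/-- The orthogonal projection onto `{v | E₂* v = v, E₁* A v = 0}`. -/
noncomputable def locProj : Matrix V V ℂ :=
  G.dualIdem x 2 - (G.drgB 2 : ℂ)⁻¹ • (G.locN x * (G.locN x)ᴴ)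
    + (((G.drgC 2 : ℂ) - 1) * G.drgC 2 / (G.drgB 1 * G.drgB 2)) • G.locJ x

variable {G}

theorem locB_conjTranspose : (G.locB x)ᴴ = G.locB x := by
  simp only [locB, Matrix.conjTranspose_mul, dualIdem_conjTranspose, distMat_conjTranspose,
    mul_assoc]

theorem locJ_conjTranspose : (G.locJ x)ᴴ = G.locJ x := by
  simp only [locJ, Matrix.conjTranspose_mul, dualIdem_conjTranspose, onesMat_conjTranspose,
    mul_assoc]

theorem locN_conjTranspose :
    (G.locN x)ᴴ = G.dualIdem x 1 * G.distMat ℂ 1 * G.dualIdem x 2 := by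
  simp only [locN, Matrix.conjTranspose_mul, dualIdem_conjTranspose, distMat_conjTranspose,
    mul_assoc]

theorem locProj_conjTranspose : (G.locProj x)ᴴ = G.locProj x := by
  simp only [locProj, Matrix.conjTranspose_add, Matrix.conjTranspose_sub,
    Matrix.conjTranspose_smul, Matrix.conjTranspose_mul, Matrix.conjTranspose_conjTranspose,
    dualIdem_conjTranspose, locJ_conjTranspose]
  simp

theorem dualIdem_mul_locB : G.dualIdem x 2 * G.locB x = G.locB x := by
  simp only [locB, mul_assoc, dualIdem_mul_self_assoc]

theorem locB_mul_dualIdem : G.locB x * G.dualIdem x 2 = G.locB x := by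
  simp only [locB, mul_assoc, dualIdem_mul_self]

theorem dualIdem_mul_locJ : G.dualIdem x 2 * G.locJ x = G.locJ x := by
  simp only [locJ, mul_assoc, dualIdem_mul_self_assoc]

theorem dualIdem_mul_locN : G.dualIdem x 2 * G.locN x = G.locN x := by
  simp only [locN, mul_assoc, dualIdem_mul_self_assoc]

theorem dualIdem_mul_locProj : G.dualIdem x 2 * G.locProj x = G.locProj x := by
  rw [locProj, mul_add, mul_sub, mul_smul_comm, mul_smul_comm, ← mul_assoc, dualIdem_mul_locN,
    dualIdem_mul_locJ, dualIdem_mul_self]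

theorem locProj_mul_dualIdem : G.locProj x * G.dualIdem x 2 = G.locProj x := by
  have h := congrArg Matrix.conjTranspose (dualIdem_mul_locProj (G := G) x)
  rwa [Matrix.conjTranspose_mul, locProj_conjTranspose, dualIdem_conjTranspose] at h

/-- The number of vertices at distance two from `x`. -/
noncomputable def valencyTwo (G : SimpleGraph V) (x : V) : ℕ :=
  (Finset.univ.filter fun y => G.dist x y = 2).card

omit [DecidableEq V] in
theorem onesMat_mul_apply (M : Matrix V V ℂ) (y z : V) :
    (onesMat V * M) y z = ∑ w, M w z := by
  simp [Matrix.mul_apply, onesMat_apply]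

theorem onesMat_mul_dualIdem_mul_onesMat (i : ℕ) : onesMat V * (G.dualIdem x i * onesMat V)
    = ((Finset.univ.filter fun y => G.dist x y = i).card : ℂ) • onesMat V := by
  ext y z
  rw [onesMat_mul_apply]
  simp [dualIdem_mul_apply, onesMat_apply]

theorem trace_dualIdem (i : ℕ) : (G.dualIdem x i).trace
    = ((Finset.univ.filter fun y => G.dist x y = i).card : ℂ) := by
  simp [dualIdem, Matrix.trace_diagonal]

theorem trace_dualIdem_mul_onesMat_mul_dualIdem (i : ℕ) :
    (G.dualIdem x i * onesMat V * G.dualIdem x i).trace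
      = ((Finset.univ.filter fun y => G.dist x y = i).card : ℂ) := by
  simp only [Matrix.trace, Matrix.diag_apply, mul_dualIdem_apply, dualIdem_mul_apply,
    onesMat_apply, ← Finset.sum_boole]
  refine Finset.sum_congr rfl fun y _ => ?_
  split_ifs <;> rfl

theorem trace_locJ : (G.locJ x).trace = G.valencyTwo x :=
  trace_dualIdem_mul_onesMat_mul_dualIdem x 2

theorem trace_locB : (G.locB x).trace = 0 := by
  simp [Matrix.trace, locB, mul_dualIdem_apply, dualIdem_mul_apply, distMat_apply]

namespace IsBipartiteDRG

variable (hG : G.IsBipartiteDRG)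
include hG

theorem dualIdem_mul_distMat_mul_dualIdem_mul_onesMat {i j h : ℕ} (hj : j ≤ G.diam)
    (hh : h ≤ G.diam) :
    G.dualIdem x i * (G.distMat ℂ j * (G.dualIdem x h * onesMat V))
      = (G.interNum i j h : ℂ) • (G.dualIdem x i * onesMat V) := by
  ext y z
  rw [dualIdem_mul_apply, Matrix.smul_apply, dualIdem_mul_apply, distMat_mul_apply]
  split_ifs with h1
  · have h2 : G.dist y x = i := by rw [G.dist_comm, h1]
    rw [← h2, ← hG.distCount_eq hj hh]
    simp only [dualIdem_mul_apply, onesMat_apply, smul_eq_mul, mul_one, distCount]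
    rw [Finset.sum_boole, Finset.filter_filter]
    simp only [G.dist_comm (u := x)]
  · simp

theorem locN_mul_onesMat (h4 : 4 ≤ G.diam) :
    G.locN x * onesMat V = (G.drgC 2 : ℂ) • (G.dualIdem x 2 * onesMat V) := by
  rw [locN, mul_assoc, mul_assoc,
    hG.dualIdem_mul_distMat_mul_dualIdem_mul_onesMat x (by omega) (by omega)]
  rfl

theorem locN_conjTranspose_mul_onesMat (h4 : 4 ≤ G.diam) :
    (G.locN x)ᴴ * onesMat V = (G.drgB 1 : ℂ) • (G.dualIdem x 1 * onesMat V) := by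
  rw [locN_conjTranspose, mul_assoc, mul_assoc,
    hG.dualIdem_mul_distMat_mul_dualIdem_mul_onesMat x (by omega) (by omega)]
  rfl

theorem locB_mul_onesMat (h4 : 4 ≤ G.diam) :
    G.locB x * onesMat V = (G.interNum 2 2 2 : ℂ) • (G.dualIdem x 2 * onesMat V) := by
  rw [locB, mul_assoc, mul_assoc,
    hG.dualIdem_mul_distMat_mul_dualIdem_mul_onesMat x (by omega) (by omega)]

theorem onesMat_mul_locN (h4 : 4 ≤ G.diam) :
    onesMat V * G.locN x = (G.drgB 1 : ℂ) • (onesMat V * G.dualIdem x 1) := by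
  have h := congrArg Matrix.conjTranspose (hG.locN_conjTranspose_mul_onesMat x h4)
  simpa [Matrix.conjTranspose_mul, onesMat_conjTranspose, dualIdem_conjTranspose] using h

theorem onesMat_mul_locN_conjTranspose (h4 : 4 ≤ G.diam) :
    onesMat V * (G.locN x)ᴴ = (G.drgC 2 : ℂ) • (onesMat V * G.dualIdem x 2) := by
  have h := congrArg Matrix.conjTranspose (hG.locN_mul_onesMat x h4)
  simpa [Matrix.conjTranspose_mul, onesMat_conjTranspose, dualIdem_conjTranspose] using h

theorem locB_mul_locJ (h4 : 4 ≤ G.diam) :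
    G.locB x * G.locJ x = (G.interNum 2 2 2 : ℂ) • G.locJ x := by
  rw [locJ, ← mul_assoc, ← mul_assoc, locB_mul_dualIdem, hG.locB_mul_onesMat x h4,
    smul_mul_assoc]

/-- `E₂* M E₁*` only involves `M` between distances two and one from `x`: `E₂* A E₁*` equals
`(1 - E₀*) A E₁*`. -/
theorem locN_eq : G.locN x = (1 - G.dualIdem x 0) * G.distMat ℂ 1 * G.dualIdem x 1 := by
  ext y z
  rw [locN, mul_dualIdem_apply, mul_dualIdem_apply, sub_mul, one_mul, Matrix.sub_apply,
    dualIdem_mul_apply, dualIdem_mul_apply]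
  simp only [distMat_apply]
  have := hG.even_dist x y z
  have := hG.dist_tri x z y
  rw [G.dist_comm (u := z)] at this
  split_ifs <;> first | omega | simp

theorem mul_dualIdem_zero_mul_apply (M N : Matrix V V ℂ) (y z : V) :
    (M * G.dualIdem x 0 * N) y z = M y x * N x z := by
  rw [Matrix.mul_apply, Finset.sum_eq_single x]
  · simp [mul_dualIdem_apply]
  · intro w _ hw
    rw [mul_dualIdem_apply, if_neg (fun h => hw (hG.conn.dist_eq_zero_iff.1 h).symm), zero_mul]
  · simp

/-- The entries count 2-walks between neighbours of x that avoid x: k - 1 = b_2 + (c_2 - 1) on the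
diagonal, and c_2 - 1 elsewhere, since distinct neighbours of x are at distance 2. -/
theorem locN_conjTranspose_mul_locN (h4 : 4 ≤ G.diam) :
    (G.locN x)ᴴ * G.locN x = (G.drgB 2 : ℂ) • G.dualIdem x 1
      + ((G.drgC 2 : ℂ) - 1) • (G.dualIdem x 1 * onesMat V * G.dualIdem x 1) := by
  have e1 : (G.locN x)ᴴ * G.locN x = G.dualIdem x 1 *
      (G.distMat ℂ 1 * G.distMat ℂ 1 - G.distMat ℂ 1 * G.dualIdem x 0 * G.distMat ℂ 1)
      * G.dualIdem x 1 := by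
    rw [locN_conjTranspose, mul_assoc (G.dualIdem x 1 * G.distMat ℂ 1), dualIdem_mul_locN,
      hG.locN_eq]
    noncomm_ring
  have e2 : (G.drgB 2 : ℂ) • G.dualIdem x 1
      + ((G.drgC 2 : ℂ) - 1) • (G.dualIdem x 1 * onesMat V * G.dualIdem x 1)
      = G.dualIdem x 1 * ((G.drgB 2 : ℂ) • (1 : Matrix V V ℂ)
        + ((G.drgC 2 : ℂ) - 1) • onesMat V) * G.dualIdem x 1 := by
    rw [mul_add, add_mul, mul_smul_comm, mul_smul_comm, smul_mul_assoc, smul_mul_assoc, mul_one,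
      dualIdem_mul_self]
  rw [e1, e2]
  refine sandwich_ext x fun y z hy hz => ?_
  have hk := hG.drgC_add_drgB (i := 2) (by omega) (by omega)
  have h0 := hG.distMat_one_mul (R := ℂ) (by omega) 0
  rw [zero_add, zero_add] at h0
  rw [h0, Matrix.sub_apply, hG.mul_dualIdem_zero_mul_apply, Matrix.add_apply, Matrix.add_apply,
    Matrix.smul_apply, Matrix.smul_apply, Matrix.smul_apply, Matrix.smul_apply, onesMat_apply,
    hG.distMat_zero, drgB_zero, ← hk]
  have hev := hG.even_dist x y z
  have htr := hG.dist_tri y x z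
  simp only [distMat_apply, G.dist_comm (u := y) (v := x), hy, hz, if_true, Matrix.one_apply]
  rw [G.dist_comm (u := y) (v := x)] at htr
  by_cases hyz : y = z
  · subst hyz
    simp
    ring
  · have := (hG.conn.dist_eq_zero_iff (u := y) (v := z)).not.2 hyz
    rw [if_neg hyz, if_pos (by omega)]
    simp

/-- A_2 A = b_1 A + c_3 A_3, with the contribution through x removed. Between a vertex at distance 2
from x and a neighbour of x only distances 1 and 3 occur, giving entries b_1 - 1 and c_3 - 1. -/
theorem locB_mul_locN (h4 : 4 ≤ G.diam) :
    G.locB x * G.locN x = ((G.drgB 1 : ℂ) - G.drgC 3) • G.locN x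
      + ((G.drgC 3 : ℂ) - 1) • (G.dualIdem x 2 * onesMat V * G.dualIdem x 1) := by
  have e1 : G.locB x * G.locN x = G.dualIdem x 2 *
      (G.distMat ℂ 2 * G.distMat ℂ 1 - G.distMat ℂ 2 * G.dualIdem x 0 * G.distMat ℂ 1)
      * G.dualIdem x 1 := by
    rw [locB, mul_assoc, dualIdem_mul_locN, hG.locN_eq]
    noncomm_ring
  have e2 : ((G.drgB 1 : ℂ) - G.drgC 3) • G.locN x
      + ((G.drgC 3 : ℂ) - 1) • (G.dualIdem x 2 * onesMat V * G.dualIdem x 1)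
      = G.dualIdem x 2 * (((G.drgB 1 : ℂ) - G.drgC 3) • G.distMat ℂ 1
        + ((G.drgC 3 : ℂ) - 1) • onesMat V) * G.dualIdem x 1 := by
    rw [locN, mul_add, add_mul, mul_smul_comm, mul_smul_comm, smul_mul_assoc, smul_mul_assoc]
  rw [e1, e2]
  refine sandwich_ext x fun y z hy hz => ?_
  have h0 := hG.distMat_one_mul (R := ℂ) (by omega) 1
  norm_num at h0
  rw [hG.commute_distMat_one (by omega), h0, Matrix.sub_apply, hG.mul_dualIdem_zero_mul_apply,
    Matrix.add_apply, Matrix.add_apply, Matrix.smul_apply, Matrix.smul_apply, Matrix.smul_apply,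
    Matrix.smul_apply, onesMat_apply]
  have hev := hG.even_dist x y z
  have htr := hG.dist_tri y x z
  have htr' := hG.dist_tri x z y
  rw [G.dist_comm (u := z)] at htr'
  rw [G.dist_comm (u := y) (v := x)] at htr
  simp only [distMat_apply, G.dist_comm (u := y) (v := x), hy, hz, if_true]
  by_cases hyz : G.dist y z = 1
  · simp [hyz]
  · rw [if_neg hyz, if_pos (by omega)]
    simp

/-- B is a symmetric 0-1 matrix, so tr B² is the sum of its entries. -/
theorem trace_locB_mul_locB (h4 : 4 ≤ G.diam) :
    (G.locB x * G.locB x).trace = (G.interNum 2 2 2 : ℂ) * G.valencyTwo x := by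
  have h := congrArg Matrix.trace (hG.locB_mul_locJ x h4)
  rw [Matrix.trace_smul, trace_locJ, smul_eq_mul] at h
  rw [← h]
  refine Finset.sum_congr rfl fun y _ => ?_
  rw [Matrix.diag_apply, Matrix.diag_apply, Matrix.mul_apply, Matrix.mul_apply]
  refine Finset.sum_congr rfl fun z _ => ?_
  simp only [locB, locJ, mul_dualIdem_apply, dualIdem_mul_apply, distMat_apply, onesMat_apply]
  rw [G.dist_comm (u := z)]
  split_ifs <;> simp

/-- `k₂ c₂ = k b₁`. -/
theorem valencyTwo_mul (h4 : 4 ≤ G.diam) :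
    (G.valencyTwo x : ℂ) * G.drgC 2 = G.valency * G.drgB 1 := by
  -- The edges between distances 1 and 2 from x are counted from either end.
  have h : onesMat V * (G.locN x * onesMat V) = (onesMat V * G.locN x) * onesMat V :=
    (mul_assoc _ _ _).symm
  rw [hG.locN_mul_onesMat x h4, hG.onesMat_mul_locN x h4, mul_smul_comm, smul_mul_assoc,
    mul_assoc, onesMat_mul_dualIdem_mul_onesMat, onesMat_mul_dualIdem_mul_onesMat,
    hG.card_dist_one (by omega), ← valencyTwo] at h
  have h2 := congrFun (congrFun h x) x
  simp only [Matrix.smul_apply, onesMat_apply, smul_eq_mul, mul_one] at h2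
  linear_combination h2

/-- `c₂ p²₂₂ = (b₁ - c₃) c₂ + (c₃ - 1) k`. -/
theorem drgC_two_mul_interNum (h4 : 4 ≤ G.diam) :
    (G.drgC 2 : ℂ) * G.interNum 2 2 2
      = ((G.drgB 1 : ℂ) - G.drgC 3) * G.drgC 2 + ((G.drgC 3 : ℂ) - 1) * G.valency := by
  obtain ⟨u, v, huv⟩ := hG.drg.exists_dist_eq (i := 2) (by omega)
  -- Row sums of B N are evaluated in two ways and compared at a vertex v at distance 2 from u.
  have h : G.locB u * (G.locN u * onesMat V) = (G.locB u * G.locN u) * onesMat V :=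
    (mul_assoc _ _ _).symm
  rw [hG.locN_mul_onesMat u h4, hG.locB_mul_locN u h4, mul_smul_comm, ← mul_assoc,
    locB_mul_dualIdem, hG.locB_mul_onesMat u h4, add_mul, smul_mul_assoc, smul_mul_assoc,
    hG.locN_mul_onesMat u h4, mul_assoc, mul_assoc, onesMat_mul_dualIdem_mul_onesMat,
    hG.card_dist_one (by omega)] at h
  have h2 := congrFun (congrFun h v) v
  simp only [Matrix.smul_apply, Matrix.add_apply, onesMat_apply, smul_eq_mul, mul_one,
    dualIdem_mul_apply, huv, if_true] at h2
  linear_combination h2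

end IsBipartiteDRG

end Local

end SimpleGraph

namespace SimpleGraph

/-! ### The projection P and the traces of P, BP and B²P. -/

section LocalProjection

variable {V : Type*} [Fintype V] [DecidableEq V] {G : SimpleGraph V}

namespace IsBipartiteDRG

variable (hG : G.IsBipartiteDRG) (x : V)
include hG

theorem cast_drgB_ne_zero {i : ℕ} (hi : i < G.diam) : (G.drgB i : ℂ) ≠ 0 :=
  Nat.cast_ne_zero.2 (hG.drgB_pos hi).ne'

theorem cast_drgC_ne_zero {i : ℕ} (h1 : 1 ≤ i) (hi : i ≤ G.diam) : (G.drgC i : ℂ) ≠ 0 :=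
  Nat.cast_ne_zero.2 (hG.drgC_pos h1 hi).ne'

/-- N^* N is b_2 times the identity plus a multiple of J on the neighbours of x. Thus N N^*/b_2 is a
projection up to a multiple of E_2^* J E_2^*, and the last coefficient in `locProj` is the one that
cancels this error. -/
theorem locN_conjTranspose_mul_locProj (h4 : 4 ≤ G.diam) :
    (G.locN x)ᴴ * G.locProj x = 0 := by
  have hb1 := hG.cast_drgB_ne_zero (i := 1) (by omega)
  have hb2 := hG.cast_drgB_ne_zero (i := 2) (by omega)
  have e1 : (G.locN x)ᴴ * G.dualIdem x 2 = (G.locN x)ᴴ := by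
    rw [locN_conjTranspose, mul_assoc, dualIdem_mul_self]
  have e2 : G.dualIdem x 1 * (G.locN x)ᴴ = (G.locN x)ᴴ := by
    rw [locN_conjTranspose, mul_assoc (G.dualIdem x 1), dualIdem_mul_self_assoc]
  have e3 : (G.locN x)ᴴ * (G.locN x * (G.locN x)ᴴ) = (G.drgB 2 : ℂ) • (G.locN x)ᴴ
      + (((G.drgC 2 : ℂ) - 1) * G.drgC 2) •
        (G.dualIdem x 1 * (onesMat V * G.dualIdem x 2)) := by
    rw [← mul_assoc, hG.locN_conjTranspose_mul_locN x h4, add_mul, smul_mul_assoc,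
      smul_mul_assoc, e2, mul_assoc, e2, mul_assoc, hG.onesMat_mul_locN_conjTranspose x h4,
      mul_smul_comm, smul_smul]
  have e4 : (G.locN x)ᴴ * G.locJ x
      = (G.drgB 1 : ℂ) • (G.dualIdem x 1 * (onesMat V * G.dualIdem x 2)) := by
    rw [locJ, ← mul_assoc, ← mul_assoc, e1, hG.locN_conjTranspose_mul_onesMat x h4,
      smul_mul_assoc, mul_assoc]
  rw [locProj, mul_add, mul_sub, mul_smul_comm, mul_smul_comm, e1, e3, e4, smul_add, smul_smul,
    smul_smul, smul_smul, inv_mul_cancel₀ hb2, one_smul,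
    show ((G.drgC 2 : ℂ) - 1) * G.drgC 2 / (G.drgB 1 * G.drgB 2) * G.drgB 1
      = (G.drgB 2 : ℂ)⁻¹ * (((G.drgC 2 : ℂ) - 1) * G.drgC 2) by field_simp]
  abel

theorem onesMat_mul_locProj (h4 : 4 ≤ G.diam) : onesMat V * G.locProj x = 0 := by
  have hc2 := hG.cast_drgC_ne_zero (i := 2) (by omega) (by omega)
  have h : (G.drgC 2 : ℂ) • (onesMat V * G.locProj x) = 0 := by
    rw [← dualIdem_mul_locProj, ← mul_assoc, ← smul_mul_assoc,
      ← hG.onesMat_mul_locN_conjTranspose x h4, mul_assoc,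
      hG.locN_conjTranspose_mul_locProj x h4, mul_zero]
  exact (smul_eq_zero.1 h).resolve_left hc2

theorem locJ_mul_locProj (h4 : 4 ≤ G.diam) : G.locJ x * G.locProj x = 0 := by
  rw [locJ, mul_assoc, dualIdem_mul_locProj, mul_assoc, hG.onesMat_mul_locProj x h4, mul_zero]

theorem locProj_mul_self (h4 : 4 ≤ G.diam) : G.locProj x * G.locProj x = G.locProj x := by
  conv_lhs => enter [1]; rw [locProj]
  rw [add_mul, sub_mul, smul_mul_assoc, smul_mul_assoc, mul_assoc,
    hG.locN_conjTranspose_mul_locProj x h4, hG.locJ_mul_locProj x h4, dualIdem_mul_locProj]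
  simp

/-- The relation J N^* = c_2 J E_2^* shows that N^* v = 0 forces the entries of v to sum to zero, so
both correction terms of P vanish on v. -/
theorem locProj_mulVec_eq (h4 : 4 ≤ G.diam) {v : V → ℂ} (h2 : G.dualIdem x 2 *ᵥ v = v)
    (h1 : (G.locN x)ᴴ *ᵥ v = 0) : G.locProj x *ᵥ v = v := by
  have hc2 := hG.cast_drgC_ne_zero (i := 2) (by omega) (by omega)
  have h : (G.drgC 2 : ℂ) • (G.locJ x *ᵥ v) = 0 := by
    rw [← Matrix.smul_mulVec, locJ, mul_assoc, ← mul_smul_comm,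
      ← hG.onesMat_mul_locN_conjTranspose x h4, ← mul_assoc, ← Matrix.mulVec_mulVec, h1,
      Matrix.mulVec_zero]
  rw [locProj, Matrix.add_mulVec, Matrix.sub_mulVec, Matrix.smul_mulVec, Matrix.smul_mulVec,
    ← Matrix.mulVec_mulVec, h1, h2, (smul_eq_zero.1 h).resolve_left hc2]
  simp

theorem locB_mul_gram (h4 : 4 ≤ G.diam) : G.locB x * (G.locN x * (G.locN x)ᴴ)
    = ((G.drgB 1 : ℂ) - G.drgC 3) • (G.locN x * (G.locN x)ᴴ)
      + (((G.drgC 3 : ℂ) - 1) * G.drgC 2) • G.locJ x := by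
  have e2 : G.dualIdem x 1 * (G.locN x)ᴴ = (G.locN x)ᴴ := by
    rw [locN_conjTranspose, mul_assoc (G.dualIdem x 1), dualIdem_mul_self_assoc]
  rw [← mul_assoc, hG.locB_mul_locN x h4, add_mul, smul_mul_assoc, smul_mul_assoc, mul_assoc,
    e2, mul_assoc, hG.onesMat_mul_locN_conjTranspose x h4, mul_smul_comm, smul_smul, locJ,
    mul_assoc]

theorem locB_mul_locProj_eq (h4 : 4 ≤ G.diam) : G.locB x * G.locProj x
    = G.locB x - ((G.drgB 2 : ℂ)⁻¹ * ((G.drgB 1 : ℂ) - G.drgC 3)) •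
        (G.locN x * (G.locN x)ᴴ)
      + (((G.drgC 2 : ℂ) - 1) * G.drgC 2 / (G.drgB 1 * G.drgB 2) * G.interNum 2 2 2
        - (G.drgB 2 : ℂ)⁻¹ * (((G.drgC 3 : ℂ) - 1) * G.drgC 2)) • G.locJ x := by
  rw [locProj, mul_add, mul_sub, mul_smul_comm, mul_smul_comm, locB_mul_dualIdem,
    hG.locB_mul_gram x h4, hG.locB_mul_locJ x h4]
  module

/-- BP is a rational combination of Hermitian matrices, hence Hermitian. -/
theorem locProj_mul_locB (h4 : 4 ≤ G.diam) :
    G.locProj x * G.locB x = G.locB x * G.locProj x := by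
  have h := congrArg Matrix.conjTranspose (hG.locB_mul_locProj_eq x h4)
  rw [Matrix.conjTranspose_mul, locProj_conjTranspose, locB_conjTranspose] at h
  rw [h, hG.locB_mul_locProj_eq x h4]
  simp [Matrix.conjTranspose_add, Matrix.conjTranspose_sub, Matrix.conjTranspose_smul,
    locB_conjTranspose, locJ_conjTranspose]

theorem trace_gram (h4 : 4 ≤ G.diam) :
    (G.locN x * (G.locN x)ᴴ).trace = (G.valency : ℂ) * G.drgB 1 := by
  have e1 := hG.drgC_add_drgB (i := 1) (by omega) (by omega)
  have e2 := hG.drgC_add_drgB (i := 2) (by omega) (by omega)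
  rw [hG.drgC_one (by omega)] at e1
  have e3 : (1 : ℂ) + G.drgB 1 = G.drgC 2 + G.drgB 2 := by
    have : 1 + G.drgB 1 = G.drgC 2 + G.drgB 2 := by omega
    exact_mod_cast this
  rw [Matrix.trace_mul_comm, hG.locN_conjTranspose_mul_locN x h4, Matrix.trace_add,
    Matrix.trace_smul, Matrix.trace_smul, trace_dualIdem,
    trace_dualIdem_mul_onesMat_mul_dualIdem, hG.card_dist_one (by omega), smul_eq_mul,
    smul_eq_mul]
  linear_combination (-(G.valency : ℂ)) * e3

theorem trace_locProj (h4 : 4 ≤ G.diam) : (G.locProj x).trace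
    = G.valencyTwo x - (G.drgB 2 : ℂ)⁻¹ * (G.valency * G.drgB 1)
      + ((G.drgC 2 : ℂ) - 1) * G.drgC 2 / (G.drgB 1 * G.drgB 2) * G.valencyTwo x := by
  rw [locProj, Matrix.trace_add, Matrix.trace_sub, Matrix.trace_smul, Matrix.trace_smul,
    trace_dualIdem, hG.trace_gram x h4, trace_locJ, smul_eq_mul, smul_eq_mul, valencyTwo]

theorem trace_locB_mul_locProj (h4 : 4 ≤ G.diam) : (G.locB x * G.locProj x).trace
    = - ((G.drgB 2 : ℂ)⁻¹ * ((G.drgB 1 : ℂ) - G.drgC 3)) * (G.valency * G.drgB 1)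
      + (((G.drgC 2 : ℂ) - 1) * G.drgC 2 / (G.drgB 1 * G.drgB 2) * G.interNum 2 2 2
        - (G.drgB 2 : ℂ)⁻¹ * (((G.drgC 3 : ℂ) - 1) * G.drgC 2)) * G.valencyTwo x := by
  rw [hG.locB_mul_locProj_eq x h4, Matrix.trace_add, Matrix.trace_sub, Matrix.trace_smul,
    Matrix.trace_smul, trace_locB, hG.trace_gram x h4, trace_locJ, smul_eq_mul, smul_eq_mul]
  ring

theorem trace_locB_mul_locB_mul_locProj (h4 : 4 ≤ G.diam) :
    (G.locB x * (G.locB x * G.locProj x)).trace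
    = (G.interNum 2 2 2 : ℂ) * G.valencyTwo x
      - ((G.drgB 2 : ℂ)⁻¹ * ((G.drgB 1 : ℂ) - G.drgC 3)) *
        (((G.drgB 1 : ℂ) - G.drgC 3) * (G.valency * G.drgB 1)
          + (((G.drgC 3 : ℂ) - 1) * G.drgC 2) * G.valencyTwo x)
      + (((G.drgC 2 : ℂ) - 1) * G.drgC 2 / (G.drgB 1 * G.drgB 2) * G.interNum 2 2 2
        - (G.drgB 2 : ℂ)⁻¹ * (((G.drgC 3 : ℂ) - 1) * G.drgC 2)) *
          (G.interNum 2 2 2 * G.valencyTwo x) := by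
  rw [hG.locB_mul_locProj_eq x h4, mul_add, mul_sub, mul_smul_comm, mul_smul_comm,
    hG.locB_mul_gram x h4, hG.locB_mul_locJ x h4, Matrix.trace_add, Matrix.trace_sub,
    Matrix.trace_smul, Matrix.trace_smul, Matrix.trace_add, Matrix.trace_smul,
    Matrix.trace_smul, Matrix.trace_smul, hG.trace_gram x h4, trace_locJ,
    hG.trace_locB_mul_locB x h4]
  simp only [smul_eq_mul]

/-- The numerical relations between the intersection numbers of a bipartite distance-regular
graph used in trace computations. -/
theorem intersection_relations (h4 : 4 ≤ G.diam) :
    (G.drgB 1 : ℂ) = G.valency - 1 ∧ (G.drgC 2 : ℂ) = G.valency - G.drgB 2 ∧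
      (G.drgC 3 : ℂ) = G.valency - G.drgB 3 := by
  have e1 := hG.drgC_add_drgB (i := 1) (by omega) (by omega)
  have e2 := hG.drgC_add_drgB (i := 2) (by omega) (by omega)
  have e3 := hG.drgC_add_drgB (i := 3) (by omega) (by omega)
  rw [hG.drgC_one (by omega)] at e1
  refine ⟨?_, ?_, ?_⟩ <;> rw [eq_sub_iff_add_eq] <;> norm_cast <;> omega

theorem drgC_mul_trace_locProj (h4 : 4 ≤ G.diam) :
    (G.drgC 2 : ℂ) * (G.locProj x).trace = G.valency * (G.drgB 2 - 1) := by
  have hb1 := hG.cast_drgB_ne_zero (i := 1) (by omega)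
  have hb2 := hG.cast_drgB_ne_zero (i := 2) (by omega)
  have hk2 := hG.valencyTwo_mul x h4
  obtain ⟨r1, r2, r3⟩ := hG.intersection_relations h4
  rw [hG.trace_locProj x h4]
  rw [r1] at hb1
  have e : (G.drgC 2 : ℂ) * (G.valencyTwo x - (G.drgB 2 : ℂ)⁻¹ * (G.valency * G.drgB 1)
      + ((G.drgC 2 : ℂ) - 1) * G.drgC 2 / (G.drgB 1 * G.drgB 2) * G.valencyTwo x)
      = G.valencyTwo x * G.drgC 2 - G.drgC 2 * (G.drgB 2 : ℂ)⁻¹ * (G.valency * G.drgB 1)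
      + ((G.drgC 2 : ℂ) - 1) * G.drgC 2 / (G.drgB 1 * G.drgB 2)
        * (G.valencyTwo x * G.drgC 2) := by ring
  rw [e, hk2, r1, r2]
  field_simp
  ring

theorem trace_locB_mul_locProj_eq (h4 : 4 ≤ G.diam) : (G.locB x * G.locProj x).trace
    = -(G.interNum 2 2 2 + (G.valency - 1) * (G.drgB 3 - 1)) := by
  have hb1 := hG.cast_drgB_ne_zero (i := 1) (by omega)
  have hb2 := hG.cast_drgB_ne_zero (i := 2) (by omega)
  have hc2 := hG.cast_drgC_ne_zero (i := 2) (by omega) (by omega)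
  have hk2 : (G.valencyTwo x : ℂ) = G.valency * G.drgB 1 / G.drgC 2 := by
    rw [eq_div_iff hc2]; exact hG.valencyTwo_mul x h4
  have hp : (G.interNum 2 2 2 : ℂ) = (((G.drgB 1 : ℂ) - G.drgC 3) * G.drgC 2
      + ((G.drgC 3 : ℂ) - 1) * G.valency) / G.drgC 2 := by
    rw [eq_div_iff hc2, mul_comm]; exact hG.drgC_two_mul_interNum h4
  obtain ⟨r1, r2, r3⟩ := hG.intersection_relations h4
  rw [hG.trace_locB_mul_locProj x h4, hk2, hp, r3, r1, r2]
  rw [r1] at hb1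
  rw [r2] at hc2
  field_simp
  ring

theorem trace_locB_mul_locB_mul_locProj_eq (h4 : 4 ≤ G.diam) :
    (G.locB x * (G.locB x * G.locProj x)).trace
    = G.valencyTwo x * G.interNum 2 2 2 - (G.interNum 2 2 2 : ℂ) ^ 2
      - (G.valency - 1) * (G.drgB 3 - 1) ^ 2 := by
  have hb1 := hG.cast_drgB_ne_zero (i := 1) (by omega)
  have hb2 := hG.cast_drgB_ne_zero (i := 2) (by omega)
  have hc2 := hG.cast_drgC_ne_zero (i := 2) (by omega) (by omega)
  have hk2 : (G.valencyTwo x : ℂ) = G.valency * G.drgB 1 / G.drgC 2 := by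
    rw [eq_div_iff hc2]; exact hG.valencyTwo_mul x h4
  have hp : (G.interNum 2 2 2 : ℂ) = (((G.drgB 1 : ℂ) - G.drgC 3) * G.drgC 2
      + ((G.drgC 3 : ℂ) - 1) * G.valency) / G.drgC 2 := by
    rw [eq_div_iff hc2, mul_comm]; exact hG.drgC_two_mul_interNum h4
  obtain ⟨r1, r2, r3⟩ := hG.intersection_relations h4
  rw [hG.trace_locB_mul_locB_mul_locProj x h4, hk2, hp, r3, r1, r2]
  rw [r1] at hb1
  rw [r2] at hc2
  field_simp
  ring

end IsBipartiteDRG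

end LocalProjection

end SimpleGraph

namespace SimpleGraph

/-! ### The trace of (B - θ̃_1)(B - θ̃_d)P and the taut equation. -/

section TautTrace

variable {V : Type*} [Fintype V] [DecidableEq V] {G : SimpleGraph V} [DecidableRel G.Adj]

variable (G) in
/-- The matrix `(B - θ̃₁)(B - θ̃_d) P`, where `B = E₂* A₂ E₂*` and `P` is `locProj`. -/
noncomputable def tautMat (x : V) : Matrix V V ℂ :=
  (G.locB x - (G.tildeVal (G.theta 1) : ℂ) • (1 : Matrix V V ℂ)) *
    ((G.locB x - (G.tildeVal (G.theta (G.diam / 2)) : ℂ) • (1 : Matrix V V ℂ)) * G.locProj x)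

namespace IsBipartiteDRG

variable (hG : G.IsBipartiteDRG)
include hG

omit [DecidableEq V] [DecidableRel G.Adj] in
theorem real_intersection_relations (h4 : 4 ≤ G.diam) :
    (G.drgB 1 : ℝ) = G.valency - 1 ∧ (G.drgC 2 : ℝ) = G.valency - G.drgB 2 ∧
      (G.drgC 3 : ℝ) = G.valency - G.drgB 3 := by
  have e1 := hG.drgC_add_drgB (i := 1) (by omega) (by omega)
  have e2 := hG.drgC_add_drgB (i := 2) (by omega) (by omega)
  have e3 := hG.drgC_add_drgB (i := 3) (by omega) (by omega)
  rw [hG.drgC_one (by omega)] at e1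
  refine ⟨?_, ?_, ?_⟩ <;> rw [eq_sub_iff_add_eq] <;> norm_cast <;> omega

/-- This is where θ̃ comes from: -θ̃ is the ratio (e_0 - e_4)/(e_2 - e_4). -/
theorem cosine_sub (h4 : 4 ≤ G.diam) {θ : ℝ} {E : Matrix V V ℝ} {e : ℕ → ℝ}
    (he : ∀ y z, E y z = e (G.dist y z)) (he0 : 0 < e 0)
    (hE : G.adjMatrix ℝ * E = θ • E) (hk : θ ^ 2 ≠ (G.valency : ℝ) ^ 2)
    (hb : θ ^ 2 ≠ G.drgB 2) :
    e 0 - e 4 = -G.tildeVal θ * (e 2 - e 4) ∧ e 2 - e 4 ≠ 0 := by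
  have r0 := hG.cosine_recurrence (by omega) he hE (i := 0) (by omega)
  have r1 := hG.cosine_recurrence (by omega) he hE (i := 1) (by omega)
  have r2 := hG.cosine_recurrence (by omega) he hE (i := 2) (by omega)
  have r3 := hG.cosine_recurrence (by omega) he hE (i := 3) (by omega)
  rw [hG.drgC_zero, drgB_zero] at r0
  rw [hG.drgC_one (by omega)] at r1
  norm_num at r0 r1 r2 r3
  obtain ⟨s1, s2, s3⟩ := hG.real_intersection_relations h4
  have hb0 : 0 < G.valency := hG.drgB_pos (i := 0) (by omega)
  have hb1 := hG.drgB_pos (i := 1) (by omega)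
  have hb2 := hG.drgB_pos (i := 2) (by omega)
  have hb3 := hG.drgB_pos (i := 3) (by omega)
  -- Eliminating e_1 and e_3 from the four recurrences; the factored right side shows that e_2 - e_4
  -- is nonzero.
  have d1 : (G.valency * G.drgB 1 * (G.drgB 2 * G.drgB 3) : ℝ) * (e 2 - e 4)
      = e 0 * ((G.valency : ℝ) ^ 2 - θ ^ 2) * (θ ^ 2 - G.drgB 2) := by
    rw [s1] at r1 ⊢
    rw [s2] at r2
    rw [s3] at r3
    linear_combination (-(G.valency : ℝ) * (G.valency - 1) * G.drgB 2) * r3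
      - (G.valency : ℝ) * (G.valency - 1) * θ * r2
      + (G.valency : ℝ) * (G.drgB 2 * G.valency - θ ^ 2) * r1
      + ((G.valency - 1) * θ * (G.valency - G.drgB 2)
        + (G.drgB 2 * G.valency - θ ^ 2) * θ) * r0
  have d2 : (G.valency * G.drgB 1 : ℝ) * (e 0 - e 2)
      = e 0 * ((G.valency : ℝ) ^ 2 - θ ^ 2) := by
    rw [s1] at r1 ⊢
    linear_combination (-(G.valency : ℝ)) * r1 - θ * r0
  have hkb : (G.valency * G.drgB 1 : ℝ) ≠ 0 := by positivity
  have hsub : θ ^ 2 - G.drgB 2 ≠ 0 := sub_ne_zero.2 hb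
  have hsubk : (G.valency : ℝ) ^ 2 - θ ^ 2 ≠ 0 := sub_ne_zero.2 hk.symm
  constructor
  · have d3 : (e 0 - e 2) * (θ ^ 2 - G.drgB 2) = (G.drgB 2 * G.drgB 3) * (e 2 - e 4) := by
      apply mul_left_cancel₀ hkb
      linear_combination (θ ^ 2 - G.drgB 2) * d2 - d1
    rw [tildeVal]
    field_simp
    linear_combination d3
  · intro h
    rw [h, mul_zero] at d1
    exact mul_ne_zero (mul_ne_zero he0.ne' hsubk) hsub d1.symm

omit [DecidableRel G.Adj] in
theorem dualIdem_two_mul_mul (x : V) {E : Matrix V V ℂ} {e : ℕ → ℂ}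
    (he : ∀ y z, E y z = e (G.dist y z)) :
    G.dualIdem x 2 * E * G.dualIdem x 2 = (e 0 - e 4) • G.dualIdem x 2
      + (e 2 - e 4) • G.locB x + e 4 • G.locJ x := by
  have h : (e 0 - e 4) • G.dualIdem x 2 + (e 2 - e 4) • G.locB x + e 4 • G.locJ x
      = G.dualIdem x 2 * ((e 0 - e 4) • (1 : Matrix V V ℂ) + (e 2 - e 4) • G.distMat ℂ 2
        + e 4 • onesMat V) * G.dualIdem x 2 := by
    simp only [locB, locJ, mul_add, add_mul, mul_smul_comm, smul_mul_assoc, mul_one,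
      dualIdem_mul_self]
  rw [h]
  refine sandwich_ext x fun y z hy hz => ?_
  have h1 := hG.even_dist x y z
  have h2 := hG.dist_tri y x z
  rw [G.dist_comm (u := y) (v := x)] at h2
  simp only [he, Matrix.add_apply, Matrix.smul_apply, distMat_apply, onesMat_apply,
    Matrix.one_apply, smul_eq_mul]
  simp only [← hG.conn.dist_eq_zero_iff (u := y) (v := z)]
  have h3 : G.dist y z = 0 ∨ G.dist y z = 2 ∨ G.dist y z = 4 := by omega
  rcases h3 with h3 | h3 | h3 <;> simp [h3]

/-- Compress E = FᵀF to distance 2 from x and then by P: the J term dies, and `cosine_sub` gives the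
ratio of the other two coefficients. The left side is kept as a Gram matrix so that its vanishing on
a vector v passes to FPv. -/
theorem locProj_sandwich (h4 : 4 ≤ G.diam) (x : V) {F : Matrix V V ℝ} {θ : ℝ} {e : ℕ → ℝ}
    (he : ∀ y z, (Fᵀ * F) y z = e (G.dist y z)) (he0 : 0 < e 0)
    (hE : G.adjMatrix ℝ * (Fᵀ * F) = θ • (Fᵀ * F)) (hk : θ ^ 2 ≠ (G.valency : ℝ) ^ 2)
    (hb : θ ^ 2 ≠ G.drgB 2) :
    ∃ κ : ℂ, κ ≠ 0 ∧
      (F.map (fun t : ℝ => (t : ℂ)) * G.locProj x)ᴴ * (F.map (fun t : ℝ => (t : ℂ)) * G.locProj x)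
      = κ • ((G.locB x - (G.tildeVal θ : ℂ) • (1 : Matrix V V ℂ)) * G.locProj x) := by
  obtain ⟨c1, c2⟩ := hG.cosine_sub h4 he he0 hE hk hb
  refine ⟨((e 2 - e 4 : ℝ) : ℂ), Complex.ofReal_ne_zero.2 c2, ?_⟩
  have hEc : ∀ y z, ((F.map (fun t : ℝ => (t : ℂ)))ᴴ * F.map (fun t : ℝ => (t : ℂ))) y z
      = ((e (G.dist y z) : ℝ) : ℂ) := fun y z => by
    rw [← he, Matrix.mul_apply, Matrix.mul_apply, Complex.ofReal_sum]
    refine Finset.sum_congr rfl fun w _ => ?_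
    simp
  have hs := hG.dualIdem_two_mul_mul x (e := fun i => ((e i : ℝ) : ℂ)) hEc
  rw [Matrix.conjTranspose_mul, locProj_conjTranspose]
  have h1 : G.locProj x * (F.map (fun t : ℝ => (t : ℂ)))ᴴ
        * (F.map (fun t : ℝ => (t : ℂ)) * G.locProj x)
      = G.locProj x * (G.dualIdem x 2 * ((F.map (fun t : ℝ => (t : ℂ)))ᴴ
        * F.map (fun t : ℝ => (t : ℂ))) * G.dualIdem x 2) * G.locProj x := by
    have e1 : ∀ M, G.locProj x * (G.dualIdem x 2 * M) = G.locProj x * M := fun M => by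
      rw [← mul_assoc, locProj_mul_dualIdem]
    simp only [mul_assoc, e1, dualIdem_mul_locProj]
  rw [h1, hs, mul_add, mul_add, mul_smul_comm, mul_smul_comm, mul_smul_comm, add_mul, add_mul,
    smul_mul_assoc, smul_mul_assoc, smul_mul_assoc, locProj_mul_dualIdem,
    hG.locProj_mul_self x h4, mul_assoc, mul_assoc, hG.locJ_mul_locProj x h4, mul_zero,
    smul_zero, add_zero, ← mul_assoc, hG.locProj_mul_locB x h4, mul_assoc,
    hG.locProj_mul_self x h4, sub_mul, smul_mul_assoc, one_mul]
  have c1' : ((e 0 : ℝ) : ℂ) - ((e 4 : ℝ) : ℂ)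
      = -(G.tildeVal θ : ℂ) * (((e 2 : ℝ) : ℂ) - ((e 4 : ℝ) : ℂ)) := by exact_mod_cast c1
  rw [c1', Complex.ofReal_sub]
  module

omit [DecidableRel G.Adj] in
theorem locB_mul_locProj_comm (h4 : 4 ≤ G.diam) (x : V) (a : ℂ) :
    G.locProj x * (G.locB x - a • (1 : Matrix V V ℂ))
      = (G.locB x - a • (1 : Matrix V V ℂ)) * G.locProj x := by
  rw [mul_sub, sub_mul, hG.locProj_mul_locB x h4, mul_smul_comm, smul_mul_assoc, mul_one, one_mul]

theorem theta_spec (h4 : 4 ≤ G.diam) (hodd : Odd G.diam) {i : ℕ}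
    (hi : i = 1 ∨ i = G.diam / 2) :
    G.theta i ∈ spectrum ℝ (G.adjMatrix ℝ) ∧ G.theta i ^ 2 ≠ (G.valency : ℝ) ^ 2 ∧
      G.theta i ^ 2 ≠ G.drgB 2 := by
  refine ⟨hG.theta_mem (by omega) (by omega),
    (hG.theta_sq_lt (by omega) hodd (by omega) (by omega)).ne, ?_⟩
  rcases hi with rfl | rfl
  · exact (hG.drgB_two_lt_theta_one_sq h4 hodd).ne'
  · exact (hG.theta_half_sq_lt_drgB_two h4 hodd).ne

open scoped ComplexOrder in
theorem trace_tautMat_eq_zero_iff (h4 : 4 ≤ G.diam) (hodd : Odd G.diam) (x : V) :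
    (G.tautMat x).trace = 0 ↔ G.tautMat x = 0 := by
  refine ⟨fun h => ?_, fun h => by rw [h, Matrix.trace_zero]⟩
  obtain ⟨m1, k1, b1⟩ := hG.theta_spec h4 hodd (i := 1) (Or.inl rfl)
  obtain ⟨m2, k2, b2⟩ := hG.theta_spec h4 hodd (i := G.diam / 2) (Or.inr rfl)
  obtain ⟨F1, e1, he1, p1, hE1⟩ := hG.exists_gram_eigenmatrix m1
  obtain ⟨F2, e2, he2, p2, hE2⟩ := hG.exists_gram_eigenmatrix m2
  obtain ⟨κ1, hκ1, g1⟩ := hG.locProj_sandwich h4 x he1 p1 hE1 k1 b1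
  obtain ⟨κ2, hκ2, g2⟩ := hG.locProj_sandwich h4 x he2 p2 hE2 k2 b2
  generalize F1.map (fun t : ℝ => (t : ℂ)) * G.locProj x = Y1 at g1
  generalize F2.map (fun t : ℝ => (t : ℂ)) * G.locProj x = Y2 at g2
  have hprod : (Y1ᴴ * Y1) * (Y2ᴴ * Y2) = (κ1 * κ2) • G.tautMat x := by
    rw [g1, g2, smul_mul_assoc, mul_smul_comm, smul_smul, tautMat, mul_assoc,
      ← mul_assoc (G.locProj x), hG.locB_mul_locProj_comm h4, mul_assoc _ (G.locProj x),
      hG.locProj_mul_self x h4]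
  -- By cyclicity tr(Y_1^* Y_1 Y_2^* Y_2) is the squared Frobenius norm of Y_2 Y_1^*, so the zero
  -- trace kills Y_2 Y_1^* and with it the whole product.
  have ht : ((Y2 * Y1ᴴ) * (Y2 * Y1ᴴ)ᴴ).trace = 0 := by
    rw [Matrix.conjTranspose_mul, Matrix.conjTranspose_conjTranspose, mul_assoc,
      Matrix.trace_mul_comm, mul_assoc, mul_assoc, ← mul_assoc, hprod, Matrix.trace_smul, h,
      smul_zero]
  rw [Matrix.trace_mul_conjTranspose_self_eq_zero_iff] at ht
  have ht' := congrArg Matrix.conjTranspose ht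
  rw [Matrix.conjTranspose_mul, Matrix.conjTranspose_conjTranspose,
    Matrix.conjTranspose_zero] at ht'
  rw [mul_assoc, ← mul_assoc Y1, ht', zero_mul, mul_zero] at hprod
  exact (smul_eq_zero.1 hprod.symm).resolve_left (mul_ne_zero hκ1 hκ2)

open scoped ComplexOrder in
omit [DecidableRel G.Adj] in
-- If b_2 = 1 then tr P = 0, so P = 0 and tr BP = 0. The latter forces p²_22 = 0, and with c_2 = k -
-- 1 the formula for c_2 p²_22 becomes (k - 1)² - k + c_3 = 0, impossible for k ≥ 3.
theorem drgB_two_ne_one (h4 : 4 ≤ G.diam) (hk : 3 ≤ G.valency) : G.drgB 2 ≠ 1 := by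
  intro hb
  have x := hG.conn.nonempty.some
  have h0 := hG.drgC_mul_trace_locProj x h4
  rw [hb, Nat.cast_one, sub_self, mul_zero] at h0
  have h1 := (mul_eq_zero.1 h0).resolve_left (hG.cast_drgC_ne_zero (by omega) (by omega))
  rw [← hG.locProj_mul_self x h4] at h1
  conv_lhs at h1 => enter [1, 2]; rw [← locProj_conjTranspose]
  rw [Matrix.trace_mul_conjTranspose_self_eq_zero_iff] at h1
  have h2 := hG.trace_locB_mul_locProj_eq x h4
  rw [h1, mul_zero, Matrix.trace_zero, eq_comm, neg_eq_zero] at h2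
  have h3 : (G.interNum 2 2 2 : ℝ) + ((G.valency : ℝ) - 1) * ((G.drgB 3 : ℝ) - 1) = 0 := by
    exact_mod_cast h2
  have h5 : (G.drgC 2 : ℝ) * G.interNum 2 2 2
      = ((G.drgB 1 : ℝ) - G.drgC 3) * G.drgC 2 + ((G.drgC 3 : ℝ) - 1) * G.valency := by
    exact_mod_cast hG.drgC_two_mul_interNum h4
  obtain ⟨s1, s2, s3⟩ := hG.real_intersection_relations h4
  have hb3 : (1 : ℝ) ≤ G.drgB 3 := by exact_mod_cast hG.drgB_pos (i := 3) (by omega)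
  have hc3 : (1 : ℝ) ≤ G.drgC 3 := by exact_mod_cast hG.drgC_pos (i := 3) (by omega) (by omega)
  have hk' : (3 : ℝ) ≤ G.valency := by exact_mod_cast hk
  have hp : (0 : ℝ) ≤ G.interNum 2 2 2 := Nat.cast_nonneg _
  have hp0 : (G.interNum 2 2 2 : ℝ) = 0 := by
    nlinarith [mul_nonneg (show (0 : ℝ) ≤ G.valency - 1 by linarith)
      (show (0 : ℝ) ≤ G.drgB 3 - 1 by linarith)]
  rw [hb, Nat.cast_one] at s2
  rw [hp0, mul_zero, s1, s2] at h5
  nlinarith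

theorem trace_tautMat (h4 : 4 ≤ G.diam) (x : V) :
    (G.tautMat x).trace = (((G.valencyTwo x : ℝ) * G.interNum 2 2 2
      - (G.interNum 2 2 2 : ℝ) ^ 2 - (G.valency - 1) * (G.drgB 3 - 1) ^ 2)
      + (G.tildeVal (G.theta 1) + G.tildeVal (G.theta (G.diam / 2))) *
        (G.interNum 2 2 2 + (G.valency - 1) * (G.drgB 3 - 1))
      + G.tildeVal (G.theta 1) * G.tildeVal (G.theta (G.diam / 2)) *
        (G.valency * (G.drgB 2 - 1) / G.drgC 2) : ℝ) := by
  have hc2 := hG.cast_drgC_ne_zero (i := 2) (by omega) (by omega)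
  have h0 : (G.locProj x).trace = (G.valency : ℂ) * (G.drgB 2 - 1) / G.drgC 2 := by
    rw [eq_div_iff hc2, mul_comm]
    exact hG.drgC_mul_trace_locProj x h4
  have h1 := hG.trace_locB_mul_locProj_eq x h4
  have h2 := hG.trace_locB_mul_locB_mul_locProj_eq x h4
  rw [tautMat]
  simp only [sub_mul, mul_sub, smul_mul_assoc, one_mul, mul_smul_comm, Matrix.trace_sub,
    Matrix.trace_smul, smul_eq_mul, h0, h1, h2]
  push_cast
  ring

theorem isTaut_iff (h4 : 4 ≤ G.diam) (hodd : Odd G.diam) (hk : 3 ≤ G.valency) (x : V) :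
    G.IsTaut ↔ G.tautDelta ≠ 0 ∧ (G.tautMat x).trace = 0 := by
  rw [IsTaut]
  refine and_congr_right fun _ => ?_
  have hb1 : (G.drgB 1 : ℝ) ≠ 0 := Nat.cast_ne_zero.2 (hG.drgB_pos (by omega)).ne'
  have hb3 : (G.drgB 3 : ℝ) ≠ 0 := Nat.cast_ne_zero.2 (hG.drgB_pos (by omega)).ne'
  have hc2 : (G.drgC 2 : ℝ) ≠ 0 := Nat.cast_ne_zero.2 (hG.drgC_pos (by omega) (by omega)).ne'
  have hkne : (G.valency : ℝ) ≠ 0 := Nat.cast_ne_zero.2 (by omega)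
  have hb21 : (G.drgB 2 : ℝ) - 1 ≠ 0 :=
    sub_ne_zero.2 (by exact_mod_cast hG.drgB_two_ne_one h4 hk)
  have hs := sub_ne_zero.2 (hG.drgB_two_lt_theta_one_sq h4 hodd).ne'
  have ht := sub_ne_zero.2 (hG.theta_half_sq_lt_drgB_two h4 hodd).ne
  have hk2 : (G.valencyTwo x : ℝ) = G.valency * G.drgB 1 / G.drgC 2 := by
    rw [eq_div_iff hc2]; exact_mod_cast hG.valencyTwo_mul x h4
  have hp : (G.interNum 2 2 2 : ℝ) = (((G.drgB 1 : ℝ) - G.drgC 3) * G.drgC 2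
      + ((G.drgC 3 : ℝ) - 1) * G.valency) / G.drgC 2 := by
    rw [eq_div_iff hc2, mul_comm]; exact_mod_cast hG.drgC_two_mul_interNum h4
  obtain ⟨s1, s2, s3⟩ := hG.real_intersection_relations h4
  rw [hG.trace_tautMat h4 x, Complex.ofReal_eq_zero, tautDelta, tildeVal, tildeVal, hk2, hp, s3,
    s1, s2]
  rw [s2] at hc2
  generalize G.theta 1 ^ 2 = u at *
  generalize G.theta (G.diam / 2) ^ 2 = w at *
  generalize (G.valency : ℝ) = k at *
  generalize (G.drgB 2 : ℝ) = b at *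
  generalize (G.drgB 3 : ℝ) = c at *
  rw [← sub_eq_zero]
  generalize hL : c * (b * (k - 2) - (k - b - 1) * u) * (b * (k - 2) - (k - b - 1) * w) -
    (k - 1) * ((k - 2) * (k - c - 1) - (k - b - 1) *
      (((k - 1 - (k - c)) * (k - b) + (k - c - 1) * k) / (k - b))) * (u - b) * (b - w) = L
  generalize hT : k * (k - 1) / (k - b) *
      (((k - 1 - (k - c)) * (k - b) + (k - c - 1) * k) / (k - b)) -
    (((k - 1 - (k - c)) * (k - b) + (k - c - 1) * k) / (k - b)) ^ 2 - (k - 1) * (c - 1) ^ 2 +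
    (-1 - b * c / (u - b) + (-1 - b * c / (w - b))) *
      (((k - 1 - (k - c)) * (k - b) + (k - c - 1) * k) / (k - b) + (k - 1) * (c - 1)) +
    (-1 - b * c / (u - b)) * (-1 - b * c / (w - b)) * (k * (b - 1) / (k - b)) = T
  -- Here k, b, c, u, w stand for k, b_2, b_3, θ_1², θ_d², while L is the difference of the sides of
  -- the taut equation and T the trace. All factors other than L and T are nonzero, k - b being c_2.
  have key : (u - b) * (w - b) * (k - b) * (b - 1) * T = k * c * L := by
    rw [← hT, ← hL]
    field_simp
    ring
  constructor
  · intro h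
    rw [h, mul_zero] at key
    refine (mul_eq_zero.1 key).resolve_left ?_
    exact mul_ne_zero (mul_ne_zero (mul_ne_zero hs ht) hc2) hb21
  · intro h
    rw [h, mul_zero] at key
    exact (mul_eq_zero.1 key.symm).resolve_left (mul_ne_zero hkne hb3)

end IsBipartiteDRG

end TautTrace

end SimpleGraph

namespace SimpleGraph

/-! ### Modules generated by a vector supported at one distance from x. -/

section Modules

variable {V : Type*} [Fintype V] [DecidableEq V] {G : SimpleGraph V} [DecidableRel G.Adj]

theorem IsTModule.of_generators {x : V} {W : Submodule ℂ (V → ℂ)}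
    (hA : ∀ w ∈ W, G.adjMatrix ℂ *ᵥ w ∈ W)
    (hE : ∀ i ≤ G.diam, ∀ w ∈ W, G.dualIdem x i *ᵥ w ∈ W) : G.IsTModule x W := by
  intro B hB
  rw [subconstAlg] at hB
  induction hB using Algebra.adjoin_induction with
  | mem B hB =>
    rcases hB with hB | ⟨i, hi, rfl⟩
    · rw [Set.mem_singleton_iff.1 hB]
      exact hA
    · exact hE i hi
  | algebraMap r =>
    intro w hw
    rw [Algebra.algebraMap_eq_smul_one, Matrix.smul_mulVec, Matrix.one_mulVec]
    exact W.smul_mem r hw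
  | add B C _ _ hB hC =>
    intro w hw
    rw [Matrix.add_mulVec]
    exact W.add_mem (hB w hw) (hC w hw)
  | mul B C _ _ hB hC =>
    intro w hw
    rw [← Matrix.mulVec_mulVec]
    exact hB _ (hC w hw)

theorem IsTModule.adjMatrix_mulVec_mem {x : V} {W : Submodule ℂ (V → ℂ)} (h : G.IsTModule x W)
    {w : V → ℂ} (hw : w ∈ W) : G.adjMatrix ℂ *ᵥ w ∈ W :=
  h _ (Algebra.subset_adjoin (Or.inl rfl)) w hw

omit [DecidableRel G.Adj] in
theorem dualIdem_mulVec_apply (x : V) (i : ℕ) (w : V → ℂ) (y : V) :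
    (G.dualIdem x i *ᵥ w) y = if G.dist x y = i then w y else 0 := by
  simp [dualIdem, Matrix.mulVec_diagonal]

omit [DecidableRel G.Adj] in
theorem dualIdem_mulVec_self (x : V) (i : ℕ) (w : V → ℂ) :
    G.dualIdem x i *ᵥ (G.dualIdem x i *ᵥ w) = G.dualIdem x i *ᵥ w := by
  rw [Matrix.mulVec_mulVec, dualIdem_mul_self]

omit [DecidableEq V] [DecidableRel G.Adj] in
theorem distMat_mulVec_apply (j : ℕ) (v : V → ℂ) (y : V) :
    (G.distMat ℂ j *ᵥ v) y = ∑ z, if G.dist y z = j then v z else 0 := by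
  simp [Matrix.mulVec, dotProduct, distMat_apply]

omit [DecidableRel G.Adj] in
theorem mem_dualPart {x : V} {i : ℕ} {W : Submodule ℂ (V → ℂ)} {v : V → ℂ} :
    v ∈ G.dualPart x i W ↔ ∃ w ∈ W, G.dualIdem x i *ᵥ w = v := by
  simp [dualPart, Submodule.mem_map]

omit [DecidableRel G.Adj] in
theorem dualIdem_mulVec_eq_zero_of_lt_endpoint {x : V} {i : ℕ} {W : Submodule ℂ (V → ℂ)}
    (hd : i ≤ G.diam) (hi : i < G.endpoint x W) {w : V → ℂ} (hw : w ∈ W) :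
    G.dualIdem x i *ᵥ w = 0 := by
  by_contra h
  have hmem : i ∈ {i : ℕ | i ≤ G.diam ∧ G.dualPart x i W ≠ ⊥} := by
    refine ⟨hd, fun hb => h ?_⟩
    have h2 : G.dualIdem x i *ᵥ w ∈ G.dualPart x i W := mem_dualPart.2 ⟨w, hw, rfl⟩
    rwa [hb, Submodule.mem_bot] at h2
  exact absurd (Nat.sInf_le hmem) (not_le.2 hi)

variable (G) in
/-- The span of the vectors `A_j v`. -/
noncomputable def cyclicSpan (v : V → ℂ) : Submodule ℂ (V → ℂ) :=
  Submodule.span ℂ (Set.range fun j => G.distMat ℂ j *ᵥ v)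

omit [DecidableEq V] [DecidableRel G.Adj] in
theorem distMat_mulVec_mem_cyclicSpan (v : V → ℂ) (j : ℕ) :
    G.distMat ℂ j *ᵥ v ∈ G.cyclicSpan v :=
  Submodule.subset_span ⟨j, rfl⟩

namespace IsBipartiteDRG

variable (hG : G.IsBipartiteDRG)
include hG

omit [DecidableRel G.Adj] in
theorem sum_dualIdem_mulVec (x : V) (w : V → ℂ) :
    ∑ i ∈ Finset.range (G.diam + 1), G.dualIdem x i *ᵥ w = w := by
  ext y
  rw [Finset.sum_apply]
  simp only [dualIdem_mulVec_apply]
  rw [Finset.sum_ite_eq, if_pos (Finset.mem_range.2 (Nat.lt_succ_of_le (hG.dist_le x y)))]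

omit [DecidableRel G.Adj] in
theorem dualIdem_eq_zero (x : V) {i : ℕ} (hi : G.diam < i) : G.dualIdem x i = 0 := by
  ext y z
  have := hG.dist_le x y
  simp only [dualIdem, Matrix.diagonal_apply, Matrix.zero_apply]
  split_ifs <;> first | omega | rfl

theorem dualIdem_mulVec_mem {x : V} {W : Submodule ℂ (V → ℂ)} (h : G.IsTModule x W) (i : ℕ)
    {w : V → ℂ} (hw : w ∈ W) : G.dualIdem x i *ᵥ w ∈ W := by
  rcases le_or_gt i G.diam with hi | hi
  · exact h _ (Algebra.subset_adjoin (Or.inr ⟨i, hi, rfl⟩)) w hw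
  · rw [hG.dualIdem_eq_zero x hi, Matrix.zero_mulVec]
    exact W.zero_mem

theorem distMat_mulVec_mem (h1 : 1 ≤ G.diam) {x : V} {W : Submodule ℂ (V → ℂ)}
    (h : G.IsTModule x W) (j : ℕ) {w : V → ℂ} (hw : w ∈ W) : G.distMat ℂ j *ᵥ w ∈ W := by
  induction j using Nat.twoStepInduction with
  | zero => rwa [hG.distMat_zero, Matrix.one_mulVec]
  | one =>
    rw [distMat_one]
    exact h.adjMatrix_mulVec_mem hw
  | more j ih1 ih2 =>
    rcases le_or_gt (j + 2) G.diam with hj | hj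
    · have hc := hG.cast_drgC_ne_zero (i := j + 2) (by omega) hj
      have e := congrArg (fun M => M *ᵥ w) (hG.distMat_one_mul (R := ℂ) h1 j)
      simp only [Matrix.add_mulVec, Matrix.smul_mulVec, ← Matrix.mulVec_mulVec, distMat_one] at e
      have e2 : (G.drgC (j + 2) : ℂ) • (G.distMat ℂ (j + 2) *ᵥ w) ∈ W := by
        rw [eq_sub_of_add_eq' e.symm]
        exact W.sub_mem (h.adjMatrix_mulVec_mem ih2) (W.smul_mem _ ih1)
      exact (W.smul_mem_iff hc).1 e2
    · rw [hG.distMat_eq_zero hj, Matrix.zero_mulVec]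
      exact W.zero_mem

omit [DecidableRel G.Adj] in
theorem distMat_mulVec_apply_eq_zero {x : V} {r : ℕ} {v : V → ℂ} (hv : G.dualIdem x r *ᵥ v = v)
    {y : V} {j : ℕ} (h : (G.dist x y + r + j) % 2 = 1 ∨ G.dist x y + r < j ∨
      j + r < G.dist x y ∨ G.dist x y + j < r) : (G.distMat ℂ j *ᵥ v) y = 0 := by
  rw [distMat_mulVec_apply]
  refine Finset.sum_eq_zero fun z _ => ?_
  split_ifs with hz
  · rw [← hv, dualIdem_mulVec_apply, if_neg]
    intro hxz
    have h1 := hG.even_dist x y z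
    have h2 := hG.dist_tri x z y
    have h3 := hG.dist_tri x y z
    have h4 := hG.dist_tri y x z
    rw [G.dist_comm (u := z)] at h2
    rw [G.dist_comm (u := y) (v := x)] at h4
    omega
  · rfl

/-- Stability under A is automatic, as the span is stable under the distance matrices. The
hypothesis says that each E_i^* A_j v lies on one line per i, which yields both stability under
E_i^* and thinness. -/
theorem cyclicSpan_isTModule (h1 : 1 ≤ G.diam) {x : V} {r : ℕ} {v : V → ℂ}
    (hv : G.dualIdem x r *ᵥ v = v)
    (H : ∀ i j, ∃ c : ℂ, G.dualIdem x i *ᵥ (G.distMat ℂ j *ᵥ v)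
      = c • (G.dualIdem x i *ᵥ (G.distMat ℂ (i - r) *ᵥ v))) :
    G.IsTModule x (G.cyclicSpan v) ∧ ∀ i, ∀ w ∈ G.cyclicSpan v, ∃ c : ℂ,
      G.dualIdem x i *ᵥ w = c • (G.dualIdem x i *ᵥ (G.distMat ℂ (i - r) *ᵥ v)) := by
  have hcomp : ∀ i, ∀ w ∈ G.cyclicSpan v, ∃ c : ℂ,
      G.dualIdem x i *ᵥ w = c • (G.dualIdem x i *ᵥ (G.distMat ℂ (i - r) *ᵥ v)) := by
    intro i w hw
    induction hw using Submodule.span_induction with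
    | mem w hw =>
      obtain ⟨j, rfl⟩ := hw
      exact H i j
    | zero => exact ⟨0, by simp⟩
    | add w w' _ _ hw hw' =>
      obtain ⟨c, hc⟩ := hw
      obtain ⟨c', hc'⟩ := hw'
      exact ⟨c + c', by rw [Matrix.mulVec_add, hc, hc', add_smul]⟩
    | smul a w _ hw =>
      obtain ⟨c, hc⟩ := hw
      exact ⟨a * c, by rw [Matrix.mulVec_smul, hc, smul_smul]⟩
  have hmem : ∀ i, G.dualIdem x i *ᵥ (G.distMat ℂ (i - r) *ᵥ v) ∈ G.cyclicSpan v := by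
    intro i
    induction i using Nat.strong_induction_on with
    | _ i ih =>
      by_cases hi : i ≤ G.diam
      swap
      · rw [hG.dualIdem_eq_zero x (not_le.1 hi), Matrix.zero_mulVec]
        exact Submodule.zero_mem _
      by_cases hir : r ≤ i
      swap
      · have h0 : G.dualIdem x i *ᵥ (G.distMat ℂ (i - r) *ᵥ v) = 0 := by
          ext y
          rw [dualIdem_mulVec_apply, Pi.zero_apply]
          split_ifs with hy
          · exact hG.distMat_mulVec_apply_eq_zero hv (by omega)
          · rfl
        rw [h0]
        exact Submodule.zero_mem _
      -- E_i^* A_{i-r} v is A_{i-r} v minus its other components: those at distance above i vanish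
      -- by the triangle inequality, and those below are multiples of vectors already treated.
      have hs := hG.sum_dualIdem_mulVec x (G.distMat ℂ (i - r) *ᵥ v)
      rw [← Finset.add_sum_erase _ _ (Finset.mem_range.2 (Nat.lt_succ_of_le hi))] at hs
      rw [eq_sub_of_add_eq hs]
      refine Submodule.sub_mem _ (distMat_mulVec_mem_cyclicSpan v _)
        (Submodule.sum_mem _ fun h hh => ?_)
      rcases lt_or_gt_of_ne (Finset.mem_erase.1 hh).1 with hlt | hgt
      · obtain ⟨c, hc⟩ := H h (i - r)
        rw [hc]
        exact Submodule.smul_mem _ _ (ih h hlt)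
      · have : G.dualIdem x h *ᵥ (G.distMat ℂ (i - r) *ᵥ v) = 0 := by
          ext y
          rw [dualIdem_mulVec_apply, Pi.zero_apply]
          split_ifs with hy
          · exact hG.distMat_mulVec_apply_eq_zero hv (by omega)
          · rfl
        rw [this]
        exact Submodule.zero_mem _
  refine ⟨IsTModule.of_generators (fun w hw => ?_) (fun i _ w hw => ?_), hcomp⟩
  · induction hw using Submodule.span_induction with
    | mem w hw =>
      obtain ⟨j, rfl⟩ := hw
      rw [← distMat_one, Matrix.mulVec_mulVec]
      cases j with
      | zero =>
        rw [hG.distMat_zero, mul_one]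
        exact distMat_mulVec_mem_cyclicSpan v 1
      | succ j =>
        rw [hG.distMat_one_mul h1, Matrix.add_mulVec, Matrix.smul_mulVec, Matrix.smul_mulVec]
        exact Submodule.add_mem _ (Submodule.smul_mem _ _ (distMat_mulVec_mem_cyclicSpan v _))
          (Submodule.smul_mem _ _ (distMat_mulVec_mem_cyclicSpan v _))
    | zero => simp
    | add w w' _ _ hw hw' =>
      rw [Matrix.mulVec_add]
      exact Submodule.add_mem _ hw hw'
    | smul a w _ hw =>
      rw [Matrix.mulVec_smul]
      exact Submodule.smul_mem _ _ hw
  · obtain ⟨c, hc⟩ := hcomp i w hw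
    rw [hc]
    exact Submodule.smul_mem _ _ (hmem i)

theorem eq_cyclicSpan (h1 : 1 ≤ G.diam) {x : V} {W : Submodule ℂ (V → ℂ)}
    (hW : G.IsIrredTModule x W) {v : V → ℂ} (hv : v ∈ W) (h0 : v ≠ 0)
    (hT : G.IsTModule x (G.cyclicSpan v)) : G.cyclicSpan v = W := by
  refine (hW.2.2 _ hT ?_).resolve_left fun hb => h0 ?_
  · refine Submodule.span_le.2 ?_
    rintro _ ⟨j, rfl⟩
    exact hG.distMat_mulVec_mem h1 hW.1 j hv
  · have h := distMat_mulVec_mem_cyclicSpan (G := G) v 0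
    rwa [hG.distMat_zero, Matrix.one_mulVec, hb, Submodule.mem_bot] at h

theorem exists_dualIdem_endpoint_ne_zero {x : V} {W : Submodule ℂ (V → ℂ)}
    (hW : G.IsIrredTModule x W) : G.endpoint x W ≤ G.diam ∧
      ∃ v ∈ W, v ≠ 0 ∧ G.dualIdem x (G.endpoint x W) *ᵥ v = v := by
  have hne : {i : ℕ | i ≤ G.diam ∧ G.dualPart x i W ≠ ⊥}.Nonempty := by
    obtain ⟨w, hw, hw0⟩ := Submodule.exists_mem_ne_zero_of_ne_bot hW.2.1
    by_contra hcon
    refine hw0 ?_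
    rw [← hG.sum_dualIdem_mulVec x w]
    refine Finset.sum_eq_zero fun i hi => ?_
    by_contra h
    refine hcon ⟨i, Nat.le_of_lt_succ (Finset.mem_range.1 hi), fun hb => h ?_⟩
    have h2 : G.dualIdem x i *ᵥ w ∈ G.dualPart x i W := mem_dualPart.2 ⟨w, hw, rfl⟩
    rwa [hb, Submodule.mem_bot] at h2
  have hm := Nat.sInf_mem hne
  refine ⟨hm.1, ?_⟩
  obtain ⟨v, hv, hv0⟩ := Submodule.exists_mem_ne_zero_of_ne_bot hm.2
  obtain ⟨w, hw, rfl⟩ := mem_dualPart.1 hv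
  exact ⟨_, hG.dualIdem_mulVec_mem hW.1 _ hw, hv0, dualIdem_mulVec_self x _ w⟩

end IsBipartiteDRG

end Modules

end SimpleGraph

namespace SimpleGraph

/-! ### Generating vectors for endpoints 0, 1 and 2. -/

section TautModules

variable {V : Type*} [Fintype V] [DecidableEq V] {G : SimpleGraph V} [DecidableRel G.Adj]

namespace IsBipartiteDRG

variable (hG : G.IsBipartiteDRG)
include hG

omit [DecidableRel G.Adj] in
theorem dualIdem_mulVec_distMat_of_endpoint_zero {x : V} {v : V → ℂ}
    (hv : G.dualIdem x 0 *ᵥ v = v) (i j : ℕ) : ∃ c : ℂ,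
      G.dualIdem x i *ᵥ (G.distMat ℂ j *ᵥ v)
        = c • (G.dualIdem x i *ᵥ (G.distMat ℂ (i - 0) *ᵥ v)) := by
  by_cases hij : i = j
  · exact ⟨1, by rw [hij, Nat.sub_zero, one_smul]⟩
  · refine ⟨0, ?_⟩
    rw [zero_smul]
    ext y
    rw [dualIdem_mulVec_apply, Pi.zero_apply]
    split_ifs with hy
    · exact hG.distMat_mulVec_apply_eq_zero hv (by omega)
    · rfl

omit [DecidableRel G.Adj] in
-- From a vertex at distance i ≥ 1 the support of v is seen only at distances i - 1 and i + 1, and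
-- the zero sum makes these two contributions opposite.
theorem dualIdem_mulVec_distMat_of_endpoint_one {x : V} {v : V → ℂ}
    (hv : G.dualIdem x 1 *ᵥ v = v) (hs : ∑ z, v z = 0) (i j : ℕ) : ∃ c : ℂ,
      G.dualIdem x i *ᵥ (G.distMat ℂ j *ᵥ v)
        = c • (G.dualIdem x i *ᵥ (G.distMat ℂ (i - 1) *ᵥ v)) := by
  have hv0 : ∀ z, G.dist x z ≠ 1 → v z = 0 := fun z hz => by
    rw [← hv, dualIdem_mulVec_apply, if_neg hz]
  have hsum : ∀ y, 1 ≤ G.dist x y → (G.distMat ℂ (G.dist x y - 1) *ᵥ v) y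
      + (G.distMat ℂ (G.dist x y + 1) *ᵥ v) y = 0 := fun y hy => by
    rw [distMat_mulVec_apply, distMat_mulVec_apply, ← Finset.sum_add_distrib]
    refine (Finset.sum_congr rfl fun z _ => ?_).trans hs
    by_cases hz : G.dist x z = 1
    · have h1 := hG.even_dist x y z
      have h2 := hG.dist_tri x z y
      have h3 := hG.dist_tri y x z
      rw [G.dist_comm (u := z)] at h2
      rw [G.dist_comm (u := y) (v := x)] at h3
      split_ifs <;> first | omega | simp
    · simp [hv0 z hz]
  have hzero : ∀ y, G.dist x y = 0 → (G.distMat ℂ 1 *ᵥ v) y = 0 := fun y hy => by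
    obtain rfl := hG.conn.dist_eq_zero_iff.1 hy
    rw [distMat_mulVec_apply]
    refine (Finset.sum_congr rfl fun z _ => ?_).trans hs
    split_ifs with h
    · rfl
    · rw [hv0 z h]
  by_cases hij : i = j + 1
  · exact ⟨1, by rw [hij, Nat.add_sub_cancel, one_smul]⟩
  by_cases hji : j = i + 1
  · refine ⟨-1, ?_⟩
    ext y
    rw [Pi.smul_apply, dualIdem_mulVec_apply, dualIdem_mulVec_apply, smul_eq_mul]
    split_ifs with hy
    · rcases Nat.eq_zero_or_pos i with h0 | h0
      · rw [hji, h0, zero_add, hzero y (by omega), Nat.zero_sub,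
          hG.distMat_mulVec_apply_eq_zero hv (by omega), mul_zero]
      · have := hsum y (by omega)
        rw [hy] at this
        rw [hji]
        linear_combination this
    · rw [mul_zero]
  · refine ⟨0, ?_⟩
    rw [zero_smul]
    ext y
    rw [dualIdem_mulVec_apply, Pi.zero_apply]
    split_ifs with hy
    · exact hG.distMat_mulVec_apply_eq_zero hv (by omega)
    · rfl

/-- If `v` is supported on distance two from `x`, sums to zero on neighbourhoods, and is
annihilated by an extremal eigenmatrix, then `E_i A_j v` is a multiple of `E_i A_{i-2} v`. -/
theorem dualIdem_mulVec_distMat_of_endpoint_two {x : V} {v : V → ℂ} {e : ℕ → ℂ}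
    (hv : G.dualIdem x 2 *ᵥ v = v) (hs : ∑ z, v z = 0)
    (hN : ∀ y, G.dist x y = 1 → (G.distMat ℂ 1 *ᵥ v) y = 0)
    (he : ∀ i, i + 2 ≤ G.diam → e i ≠ e (i + 2))
    (hE : ∀ y, ∑ z, e (G.dist y z) * v z = 0) (i j : ℕ) : ∃ c : ℂ,
      G.dualIdem x i *ᵥ (G.distMat ℂ j *ᵥ v)
        = c • (G.dualIdem x i *ᵥ (G.distMat ℂ (i - 2) *ᵥ v)) := by
  have hv0 : ∀ z, G.dist x z ≠ 2 → v z = 0 := fun z hz => by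
    rw [← hv, dualIdem_mulVec_apply, if_neg hz]
  -- From y at distance i ≥ 2 the support of v is seen only at distances i - 2, i and i + 2. Taking
  -- f = 1 and f = e gives two linear relations among three quantities.
  have hsum : ∀ (f : ℕ → ℂ) (y), 2 ≤ G.dist x y → ∑ z, f (G.dist y z) * v z
      = f (G.dist x y - 2) * (G.distMat ℂ (G.dist x y - 2) *ᵥ v) y
      + f (G.dist x y) * (G.distMat ℂ (G.dist x y) *ᵥ v) y
      + f (G.dist x y + 2) * (G.distMat ℂ (G.dist x y + 2) *ᵥ v) y := fun f y hy => by
    rw [distMat_mulVec_apply, distMat_mulVec_apply, distMat_mulVec_apply, Finset.mul_sum,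
      Finset.mul_sum, Finset.mul_sum, ← Finset.sum_add_distrib, ← Finset.sum_add_distrib]
    refine Finset.sum_congr rfl fun z _ => ?_
    by_cases hz : G.dist x z = 2
    · have h1 := hG.even_dist x y z
      have h2 := hG.dist_tri x z y
      have h3 := hG.dist_tri y x z
      have h4 := hG.dist_tri x y z
      rw [G.dist_comm (u := z)] at h2
      rw [G.dist_comm (u := y) (v := x)] at h3
      have h5 : G.dist y z = G.dist x y - 2 ∨ G.dist y z = G.dist x y
        ∨ G.dist y z = G.dist x y + 2 := by omega
      rcases h5 with h5 | h5 | h5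
      · rw [if_pos h5, if_neg (by omega), if_neg (by omega), h5]; ring
      · rw [if_neg (by omega), if_pos h5, if_neg (by omega), h5]; ring
      · rw [if_neg (by omega), if_neg (by omega), if_pos h5, h5]; ring
    · simp [hv0 z hz]
  have hzero : ∀ y j, G.dist x y < 2 → (G.distMat ℂ j *ᵥ v) y = 0 := fun y j hy => by
    by_cases hj : j = G.dist x y + 2
    swap
    · by_cases hj' : G.dist x y = 1 ∧ j = 1
      · rw [hj'.2]
        exact hN y hj'.1
      · exact hG.distMat_mulVec_apply_eq_zero hv (by omega)
    have h6 : ∑ z, v z = (G.distMat ℂ j *ᵥ v) y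
        + if G.dist x y = 1 then (G.distMat ℂ 1 *ᵥ v) y else 0 := by
      rw [distMat_mulVec_apply, distMat_mulVec_apply]
      by_cases hy1 : G.dist x y = 1
      · rw [if_pos hy1, ← Finset.sum_add_distrib]
        refine Finset.sum_congr rfl fun z _ => ?_
        by_cases hz : G.dist x z = 2
        · have h1 := hG.even_dist x y z
          have h3 := hG.dist_tri y x z
          rw [G.dist_comm (u := y) (v := x)] at h3
          split_ifs <;> first | omega | simp
        · simp [hv0 z hz]
      · rw [if_neg hy1, add_zero]
        refine Finset.sum_congr rfl fun z _ => ?_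
        by_cases hz : G.dist x z = 2
        · have hxy := hG.conn.dist_eq_zero_iff.1 (show G.dist x y = 0 by omega)
          rw [if_pos]
          rw [← hxy, hz, hj, ← hxy, dist_self]
        · simp [hv0 z hz]
    rw [hs] at h6
    split_ifs at h6 with hy1
    · rw [hN y hy1, add_zero] at h6
      exact h6.symm
    · rw [add_zero] at h6
      exact h6.symm
  by_cases hi : 2 ≤ i
  swap
  · refine ⟨0, ?_⟩
    rw [zero_smul]
    ext y
    rw [dualIdem_mulVec_apply, Pi.zero_apply]
    split_ifs with hy
    · exact hzero y j (by omega)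
    · rfl
  obtain ⟨m, hm⟩ : ∃ m : ℂ, ∀ y, G.dist x y = i → (G.distMat ℂ (i + 2) *ᵥ v) y
      = m * (G.distMat ℂ (i - 2) *ᵥ v) y := by
    by_cases hd : i + 2 ≤ G.diam
    -- Subtracting e_i times the zero-sum relation from the relation for e eliminates A_i v.
    · refine ⟨(e (i - 2) - e i) / (e i - e (i + 2)), fun y hy => ?_⟩
      have h1 := hsum e y (by omega)
      have h2 := hsum (fun _ => 1) y (by omega)
      simp only [one_mul, hs, hE, hy] at h1 h2
      have h3 : e i - e (i + 2) ≠ 0 := sub_ne_zero.2 (he i hd)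
      rw [div_mul_eq_mul_div, eq_div_iff h3]
      linear_combination h1 - e i * h2
    · refine ⟨0, fun y _ => ?_⟩
      rw [hG.distMat_eq_zero (by omega), Matrix.zero_mulVec, zero_mul, Pi.zero_apply]
  by_cases h1 : j = i - 2
  · exact ⟨1, by rw [h1, one_smul]⟩
  by_cases h2 : j = i + 2
  · refine ⟨m, ?_⟩
    ext y
    rw [Pi.smul_apply, dualIdem_mulVec_apply, dualIdem_mulVec_apply, smul_eq_mul]
    split_ifs with hy
    · rw [h2, hm y hy]
    · rw [mul_zero]
  by_cases h3 : j = i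
  · refine ⟨-1 - m, ?_⟩
    ext y
    rw [Pi.smul_apply, dualIdem_mulVec_apply, dualIdem_mulVec_apply, smul_eq_mul]
    split_ifs with hy
    · have h4 := hsum (fun _ => 1) y (by omega)
      simp only [one_mul, hs, hy] at h4
      rw [h3]
      have h5 := hm y hy
      linear_combination -h4 - h5
    · rw [mul_zero]
  · refine ⟨0, ?_⟩
    rw [zero_smul]
    ext y
    rw [dualIdem_mulVec_apply, Pi.zero_apply]
    split_ifs with hy
    · exact hG.distMat_mulVec_apply_eq_zero hv (by omega)
    · rfl

end IsBipartiteDRG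

end TautModules

end SimpleGraph

namespace SimpleGraph

/-! ### Tautness at a vertex as the vanishing of the trace matrix. -/

section Main

variable {V : Type*} [Fintype V] [DecidableEq V] {G : SimpleGraph V} [DecidableRel G.Adj]

namespace IsBipartiteDRG

variable (hG : G.IsBipartiteDRG)
include hG

omit [DecidableRel G.Adj] in
theorem locN_conjTranspose_mulVec_apply {x : V} {v : V → ℂ} (hv : G.dualIdem x 2 *ᵥ v = v)
    (y : V) : ((G.locN x)ᴴ *ᵥ v) y
      = if G.dist x y = 1 then (G.distMat ℂ 1 *ᵥ v) y else 0 := by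
  rw [locN_conjTranspose, ← Matrix.mulVec_mulVec, hv, ← Matrix.mulVec_mulVec,
    dualIdem_mulVec_apply]

omit [DecidableRel G.Adj] in
theorem locProj_mul_distMat_mul_dualIdem_zero (h4 : 4 ≤ G.diam) (x : V) :
    G.locProj x * (G.distMat ℂ 2 * G.dualIdem x 0) = 0 := by
  have h1 : G.dualIdem x 2 * G.distMat ℂ 2 * G.dualIdem x 0
      = G.dualIdem x 2 * onesMat V * G.dualIdem x 0 := by
    refine sandwich_ext x fun y z hy hz => ?_
    obtain rfl := hG.conn.dist_eq_zero_iff.1 hz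
    rw [G.dist_comm] at hy
    rw [distMat_apply, if_pos hy, onesMat_apply]
  have h2 := congrArg Matrix.conjTranspose (hG.onesMat_mul_locProj x h4)
  rw [Matrix.conjTranspose_mul, locProj_conjTranspose, onesMat_conjTranspose,
    Matrix.conjTranspose_zero] at h2
  rw [← locProj_mul_dualIdem, mul_assoc, ← mul_assoc (G.dualIdem x 2), h1, mul_assoc,
    ← mul_assoc, locProj_mul_dualIdem, ← mul_assoc, h2, zero_mul]

omit [DecidableRel G.Adj] in
theorem locProj_mul_locN (h4 : 4 ≤ G.diam) (x : V) : G.locProj x * G.locN x = 0 := by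
  have h2 := congrArg Matrix.conjTranspose (hG.locN_conjTranspose_mul_locProj x h4)
  rwa [Matrix.conjTranspose_mul, locProj_conjTranspose, Matrix.conjTranspose_conjTranspose,
    Matrix.conjTranspose_zero] at h2

theorem locN_conjTranspose_mulVec_eq_zero {x : V} {W : Submodule ℂ (V → ℂ)} (h4 : 4 ≤ G.diam)
    (hT : G.IsTModule x W) (he : 1 < G.endpoint x W) {v : V → ℂ} (hv : v ∈ W) :
    (G.locN x)ᴴ *ᵥ v = 0 := by
  rw [locN_conjTranspose, ← Matrix.mulVec_mulVec, ← Matrix.mulVec_mulVec]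
  exact dualIdem_mulVec_eq_zero_of_lt_endpoint (by omega) he
    (hG.distMat_mulVec_mem (by omega) hT 1 (hG.dualIdem_mulVec_mem hT 2 hv))

open scoped ComplexOrder in
-- The eigenvalue θ̃ makes the Gram matrix of `locProj_sandwich` kill v, so Ev = 0. This is the
-- extra relation that makes the span of the A_j v a thin module; by irreducibility it is W.
theorem thin_of_locB_eigenvector (h4 : 4 ≤ G.diam) (hodd : Odd G.diam) {n : ℕ}
    (hn : n = 1 ∨ n = G.diam / 2) {x : V} {W : Submodule ℂ (V → ℂ)}
    (hW : G.IsIrredTModule x W) {v : V → ℂ} (hvW : v ∈ W) (hv0 : v ≠ 0)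
    (hv : G.dualIdem x 2 *ᵥ v = v) (hN : (G.locN x)ᴴ *ᵥ v = 0)
    (hB : G.locB x *ᵥ v = (G.tildeVal (G.theta n) : ℂ) • v) :
    G.IsThin x W ∧ G.HasLocalEigenvalue x W (G.tildeVal (G.theta n)) := by
  obtain ⟨m, hk, hb⟩ := hG.theta_spec h4 hodd hn
  obtain ⟨F, e, he, e0, hE⟩ := hG.exists_gram_eigenmatrix m
  obtain ⟨κ, -, hκ⟩ := hG.locProj_sandwich h4 x he e0 hE hk hb
  have hP := hG.locProj_mulVec_eq x h4 hv hN
  have hpos := hG.theta_half_pos (by omega) hodd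
  have hθ0 : G.theta n ≠ 0 :=
    (hpos.trans_le (hG.theta_le (by omega) (by omega) (by omega))).ne'
  have hne : ∀ i, i + 2 ≤ G.diam → e i ≠ e (i + 2) := fun i hi => by
    -- The sign ε reflects that θ_1² is the largest and θ_d² the smallest square of a nontrivial
    -- eigenvalue.
    rcases hn with rfl | rfl
    · refine hG.cosine_ne (by omega) hθ0 (ε := -1) (by norm_num) hk (fun μ hμ => ?_) he e0 hE hi
      rcases hG.sq_mem_Icc (by omega) hodd hμ with h | h
      · exact Or.inl h
      · exact Or.inr (by linarith [h.2])
    · refine hG.cosine_ne (by omega) hθ0 (ε := 1) (by norm_num) hk (fun μ hμ => ?_) he e0 hE hi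
      rcases hG.sq_mem_Icc (by omega) hodd hμ with h | h
      · exact Or.inl h
      · exact Or.inr (by linarith [h.1])
  have hF : F.map (fun t : ℝ => (t : ℂ)) *ᵥ v = 0 := by
    have h := congrArg (fun M => M *ᵥ v) hκ
    beta_reduce at h
    rw [Matrix.smul_mulVec, ← Matrix.mulVec_mulVec (M := G.locB x - _), hP, Matrix.sub_mulVec,
      hB, Matrix.smul_mulVec, Matrix.one_mulVec, sub_self, smul_zero,
      Matrix.conjTranspose_mul_self_mulVec_eq_zero, ← Matrix.mulVec_mulVec, hP] at h
    exact h
  have hFE : ∀ y, ∑ z, ((e (G.dist y z) : ℝ) : ℂ) * v z = 0 := fun y => by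
    have h : ((F.map (fun t : ℝ => (t : ℂ)))ᴴ * F.map (fun t : ℝ => (t : ℂ))) *ᵥ v = 0 := by
      rw [← Matrix.mulVec_mulVec, hF, Matrix.mulVec_zero]
    refine (Finset.sum_congr rfl fun z _ => ?_).trans (congrFun h y)
    congr 1
    rw [← he]
    simp [Matrix.mul_apply]
  have hs : ∑ z, v z = 0 := by
    have h : onesMat V *ᵥ v = 0 := by
      rw [← hP, Matrix.mulVec_mulVec, hG.onesMat_mul_locProj x h4, Matrix.zero_mulVec]
    have h2 := congrFun h x
    simpa [Matrix.mulVec, dotProduct, onesMat_apply] using h2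
  obtain ⟨hT, hc⟩ := hG.cyclicSpan_isTModule (by omega) hv
    (hG.dualIdem_mulVec_distMat_of_endpoint_two (e := fun i => ((e i : ℝ) : ℂ)) hv hs
      (fun y hy => by
        have h := hG.locN_conjTranspose_mulVec_apply hv y
        rw [hN, if_pos hy] at h
        exact h.symm)
      (fun i hi h => hne i hi (Complex.ofReal_injective h)) hFE)
  have hWc := hG.eq_cyclicSpan (by omega) hW hvW hv0 hT
  rw [hWc] at hc
  constructor
  · intro i _
    refine (Submodule.finrank_mono (t := Submodule.span ℂ
      {G.dualIdem x i *ᵥ (G.distMat ℂ (i - 2) *ᵥ v)}) fun w hw => ?_).trans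
      ((finrank_span_le_card _).trans (by simp))
    obtain ⟨w', hw', rfl⟩ := mem_dualPart.1 hw
    obtain ⟨c, h⟩ := hc i w' hw'
    rw [h]
    exact Submodule.smul_mem _ _ (Submodule.mem_span_singleton_self _)
  · intro w hw
    obtain ⟨w', hw', rfl⟩ := mem_dualPart.1 hw
    obtain ⟨c, h⟩ := hc 2 w' hw'
    rw [hG.distMat_zero, Matrix.one_mulVec, hv] at h
    rw [h]
    change G.locB x *ᵥ (c • v) = _
    rw [Matrix.mulVec_smul, hB, smul_comm]

theorem isTautAt_of_tautMat_eq_zero (h4 : 4 ≤ G.diam) (hodd : Odd G.diam) {x : V}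
    (h0 : G.tautMat x = 0) : G.IsTautAt x := by
  intro W hW hend
  obtain ⟨-, v, hvW, hv0, hv⟩ := hG.exists_dualIdem_endpoint_ne_zero hW
  rw [hend] at hv
  have hNW : ∀ u ∈ W, (G.locN x)ᴴ *ᵥ u = 0 := fun u hu =>
    hG.locN_conjTranspose_mulVec_eq_zero h4 hW.1 (by omega) hu
  have hP := hG.locProj_mulVec_eq x h4 hv (hNW v hvW)
  set a := (G.tildeVal (G.theta 1) : ℂ)
  set b := (G.tildeVal (G.theta (G.diam / 2)) : ℂ)
  set u := (G.locB x - b • (1 : Matrix V V ℂ)) *ᵥ v with hu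
  have hub : u = G.locB x *ᵥ v - b • v := by
    rw [hu, Matrix.sub_mulVec, Matrix.smul_mulVec, Matrix.one_mulVec]
  have hua : G.locB x *ᵥ u = a • u := by
    have h := congrArg (fun M => M *ᵥ v) h0
    simp only [tautMat, Matrix.zero_mulVec] at h
    rw [← Matrix.mulVec_mulVec, ← Matrix.mulVec_mulVec, hP, Matrix.sub_mulVec,
      Matrix.smul_mulVec, Matrix.one_mulVec, sub_eq_zero] at h
    exact h
  have hBW : G.locB x *ᵥ v ∈ W := by
    rw [locB, ← Matrix.mulVec_mulVec, ← Matrix.mulVec_mulVec]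
    exact hG.dualIdem_mulVec_mem hW.1 2
      (hG.distMat_mulVec_mem (by omega) hW.1 2 (hG.dualIdem_mulVec_mem hW.1 2 hvW))
  -- Since (B - a)(B - b)v = 0, either v is an eigenvector for b or u = (B - b)v is a nonzero
  -- eigenvector for a. One eigenvector in W suffices.
  by_cases hu0 : u = 0
  · have hB : G.locB x *ᵥ v = b • v := sub_eq_zero.1 (hub.symm.trans hu0)
    obtain ⟨t, e⟩ := hG.thin_of_locB_eigenvector h4 hodd (Or.inr rfl) hW hvW hv0 hv
      (hNW v hvW) hB
    exact ⟨t, Or.inr e⟩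
  · have huW : u ∈ W := by
      rw [hub]
      exact W.sub_mem hBW (W.smul_mem _ hvW)
    have hu2 : G.dualIdem x 2 *ᵥ u = u := by
      rw [hub, Matrix.mulVec_sub, Matrix.mulVec_smul, hv, Matrix.mulVec_mulVec,
        dualIdem_mul_locB]
    obtain ⟨t, e⟩ := hG.thin_of_locB_eigenvector h4 hodd (Or.inl rfl) hW huW hu0 hu2
      (hNW u huW) hua
    exact ⟨t, Or.inl e⟩

/-- For endpoint 0 or 1 the space E_2^* W lies in the range of A_2 E_0^* or of N, which P kills; for
endpoint 2 a factor of M vanishes by tautness; for larger endpoint E_2^* W = 0. -/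
theorem tautMat_mulVec_eq_zero (h4 : 4 ≤ G.diam) {x : V} (hx : G.IsTautAt x)
    {W : Submodule ℂ (V → ℂ)} (hW : G.IsIrredTModule x W) {w : V → ℂ} (hw : w ∈ W) :
    G.tautMat x *ᵥ w = 0 := by
  have hy : G.dualIdem x 2 *ᵥ w ∈ W := hG.dualIdem_mulVec_mem hW.1 2 hw
  have key : G.locProj x *ᵥ (G.dualIdem x 2 *ᵥ w) = 0 → G.tautMat x *ᵥ w = 0 := fun h => by
    rw [Matrix.mulVec_mulVec, locProj_mul_dualIdem] at h
    rw [tautMat, ← Matrix.mulVec_mulVec, ← Matrix.mulVec_mulVec, h, Matrix.mulVec_zero,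
      Matrix.mulVec_zero]
  obtain ⟨hle, v, hvW, hv0, hv⟩ := hG.exists_dualIdem_endpoint_ne_zero hW
  rcases lt_trichotomy (G.endpoint x W) 2 with hlt | heq | hgt
  · apply key
    have h01 : G.endpoint x W = 0 ∨ G.endpoint x W = 1 := by omega
    rcases h01 with he | he
    · rw [he] at hv
      obtain ⟨hT, hc⟩ := hG.cyclicSpan_isTModule (by omega) hv
        (hG.dualIdem_mulVec_distMat_of_endpoint_zero hv)
      rw [hG.eq_cyclicSpan (by omega) hW hvW hv0 hT] at hc
      obtain ⟨c, h⟩ := hc 2 w hw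
      rw [h, ← hv, Matrix.mulVec_smul, Nat.sub_zero, Matrix.mulVec_mulVec, Matrix.mulVec_mulVec,
        Matrix.mulVec_mulVec, locProj_mul_dualIdem, mul_assoc,
        hG.locProj_mul_distMat_mul_dualIdem_zero h4, Matrix.zero_mulVec, smul_zero]
    · have hs : ∑ z, v z = 0 := by
        -- The entry of Av at x is the sum of the entries of v, and it vanishes because the endpoint
        -- is 1.
        have h := dualIdem_mulVec_eq_zero_of_lt_endpoint (x := x) (W := W) (i := 0) (Nat.zero_le _)
          (he ▸ Nat.one_pos) (hG.distMat_mulVec_mem (by omega) hW.1 1 hvW)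
        have h2 := congrFun h x
        rw [dualIdem_mulVec_apply, if_pos dist_self, distMat_mulVec_apply] at h2
        refine (Finset.sum_congr rfl fun z _ => ?_).trans h2
        rw [← hv, dualIdem_mulVec_apply, he]
        split_ifs <;> rfl
      rw [he] at hv
      obtain ⟨hT, hc⟩ := hG.cyclicSpan_isTModule (by omega) hv
        (hG.dualIdem_mulVec_distMat_of_endpoint_one hv hs)
      rw [hG.eq_cyclicSpan (by omega) hW hvW hv0 hT] at hc
      obtain ⟨c, h⟩ := hc 2 w hw
      rw [h, ← hv, Matrix.mulVec_smul, Matrix.mulVec_mulVec, Matrix.mulVec_mulVec,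
        Matrix.mulVec_mulVec, mul_assoc, mul_assoc, ← mul_assoc (G.dualIdem x 2),
        show G.dualIdem x 2 * G.distMat ℂ (2 - 1) * G.dualIdem x 1 = G.locN x from rfl,
        hG.locProj_mul_locN h4,
        Matrix.zero_mulVec, smul_zero]
  · have hy2 : G.dualIdem x 2 *ᵥ w ∈ G.dualPart x 2 W := mem_dualPart.2 ⟨w, hw, rfl⟩
    have hP := hG.locProj_mulVec_eq x h4 (dualIdem_mulVec_self x 2 w)
      (hG.locN_conjTranspose_mulVec_eq_zero h4 hW.1 (by omega) hy)
    rw [Matrix.mulVec_mulVec, locProj_mul_dualIdem] at hP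
    rw [tautMat, ← Matrix.mulVec_mulVec, ← Matrix.mulVec_mulVec, hP]
    have hsub : ∀ (c : ℂ) (u : V → ℂ), (G.locB x - c • (1 : Matrix V V ℂ)) *ᵥ u
        = G.locB x *ᵥ u - c • u := fun c u => by
      rw [Matrix.sub_mulVec, Matrix.smul_mulVec, Matrix.one_mulVec]
    rcases (hx W hW heq).2 with h | h
    · have hB : G.locB x *ᵥ (G.dualIdem x 2 *ᵥ w) = _ := h _ hy2
      rw [hsub, hsub, hB, Matrix.mulVec_sub, Matrix.mulVec_smul, Matrix.mulVec_smul, hB]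
      module
    · have hB : G.locB x *ᵥ (G.dualIdem x 2 *ᵥ w) = _ := h _ hy2
      rw [hsub, hsub, hB, sub_self, Matrix.mulVec_zero, smul_zero, sub_self]
  · apply key
    rw [dualIdem_mulVec_eq_zero_of_lt_endpoint (by omega) hgt hw, Matrix.mulVec_zero]

theorem tautMat_conjTranspose (h4 : 4 ≤ G.diam) (x : V) : (G.tautMat x)ᴴ = G.tautMat x := by
  have h1 : ∀ t : ℝ, (G.locB x - (t : ℂ) • (1 : Matrix V V ℂ))ᴴ
      = G.locB x - (t : ℂ) • (1 : Matrix V V ℂ) := fun t => by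
    rw [Matrix.conjTranspose_sub, locB_conjTranspose, Matrix.conjTranspose_smul,
      Matrix.conjTranspose_one, Complex.star_def, Complex.conj_ofReal]
  rw [tautMat, Matrix.conjTranspose_mul, Matrix.conjTranspose_mul, h1, h1,
    locProj_conjTranspose, hG.locB_mul_locProj_comm h4, mul_assoc, hG.locB_mul_locProj_comm h4,
    ← mul_assoc, ← mul_assoc]
  congr 1
  simp only [mul_sub, sub_mul, mul_smul_comm, smul_mul_assoc, mul_one, one_mul]
  module

omit hG in
theorem exists_irred_le {x : V} {K : Submodule ℂ (V → ℂ)} (hK : G.IsTModule x K) (h0 : K ≠ ⊥) :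
    ∃ W ≤ K, G.IsIrredTModule x W := by
  obtain ⟨W, ⟨hT, hne, hle⟩, hmin⟩ := WellFounded.has_min
    (wellFounded_lt (α := Submodule ℂ (V → ℂ)))
    {W | G.IsTModule x W ∧ W ≠ ⊥ ∧ W ≤ K} ⟨K, hK, h0, le_rfl⟩
  refine ⟨W, hle, hT, hne, fun W' hT' hle' => ?_⟩
  by_contra! hcon
  exact hmin W' ⟨hT', hcon.1, hle'.trans hle⟩ (lt_of_le_of_ne hle' hcon.2)

open scoped ComplexOrder in
theorem tautMat_eq_zero_of_isTautAt (h4 : 4 ≤ G.diam) {x : V} (hx : G.IsTautAt x) :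
    G.tautMat x = 0 := by
  by_contra hne
  have hadj : ∀ (M : Matrix V V ℂ), Mᴴ = M → ∀ u v : V → ℂ,
      star u ⬝ᵥ (M *ᵥ v) = star (M *ᵥ u) ⬝ᵥ v := fun M hM u v => by
    rw [Matrix.star_mulVec, hM, Matrix.dotProduct_mulVec]
  -- The orthogonal complement of all irreducible modules. The generators of T(x) are Hermitian, so
  -- K is a module; M is Hermitian and kills those modules, so K contains the range of M.
  let K : Submodule ℂ (V → ℂ) :=
    { carrier := {v | ∀ W, G.IsIrredTModule x W → ∀ w ∈ W, star w ⬝ᵥ v = 0}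
      add_mem' := fun {u v} hu hv W hW w hw => by
        rw [dotProduct_add, hu W hW w hw, hv W hW w hw, add_zero]
      zero_mem' := fun W hW w hw => dotProduct_zero _
      smul_mem' := fun c v hv W hW w hw => by
        rw [dotProduct_smul, hv W hW w hw, smul_zero] }
  have hA : (G.adjMatrix ℂ)ᴴ = G.adjMatrix ℂ := by
    rw [← distMat_one, distMat_conjTranspose]
  have hKT : G.IsTModule x K := IsTModule.of_generators
    (fun v hv W hW w hw => by
      rw [hadj _ hA]
      exact hv W hW _ (hW.1.adjMatrix_mulVec_mem hw))
    (fun i _ v hv W hW w hw => by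
      rw [hadj _ (dualIdem_conjTranspose x i)]
      exact hv W hW _ (hG.dualIdem_mulVec_mem hW.1 i hw))
  have hK0 : K ≠ ⊥ := fun hb => hne <| by
    refine Matrix.ext_of_mulVec_single fun y => ?_
    rw [Matrix.zero_mulVec]
    have hm : G.tautMat x *ᵥ Pi.single y 1 ∈ K := fun W hW w hw => by
      rw [hadj _ (hG.tautMat_conjTranspose h4 x), hG.tautMat_mulVec_eq_zero h4 hx hW hw,
        star_zero, zero_dotProduct]
    rwa [hb, Submodule.mem_bot] at hm
  -- An irreducible module inside K would be orthogonal to itself.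
  obtain ⟨W, hle, hW⟩ := exists_irred_le hKT hK0
  obtain ⟨w, hw, hw0⟩ := Submodule.exists_mem_ne_zero_of_ne_bot hW.2.1
  exact hw0 (dotProduct_star_self_eq_zero.1 (hle hw W hW w hw))

end IsBipartiteDRG

end Main

end SimpleGraph

theorem mainTheorem3 {X : Type*} [Fintype X] [DecidableEq X]
    (G : SimpleGraph X) [DecidableRel G.Adj]
    (hG : G.IsDistanceRegular) (hbip : G.IsBipartite)
    (hD : 4 ≤ G.diam) (hodd : Odd G.diam) (hk : 3 ≤ G.valency) :
    List.TFAE [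
      G.IsTaut,
      G.tautDelta ≠ 0 ∧ ∀ x : X, G.IsTautAt x,
      G.tautDelta ≠ 0 ∧ ∃ x : X, G.IsTautAt x] := by
  have h : G.IsBipartiteDRG := ⟨hG, hbip⟩
  tfae_have 1 → 2 := fun ht => ⟨ht.1, fun x => h.isTautAt_of_tautMat_eq_zero hD hodd
    ((h.trace_tautMat_eq_zero_iff hD hodd x).1 ((h.isTaut_iff hD hodd hk x).1 ht).2)⟩
  tfae_have 2 → 3 := fun ht => ⟨ht.1, h.conn.nonempty.some, ht.2 _⟩
  tfae_have 3 → 1 := fun ⟨hΔ, x, hx⟩ => (h.isTaut_iff hD hodd hk x).2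
    ⟨hΔ, (h.trace_tautMat_eq_zero_iff hD hodd x).2 (h.tautMat_eq_zero_of_isTautAt hD hx)⟩
  tfae_finish
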